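/- **Notation.** A *unitary set-operad* is a symmetric operad $\mathcal P$ in sets (composition operations $\gamma$, unit $1_{\mathcal P}\in\mathcal P(1)$) such that $\mathcal P(0)=\{0_{\mathcal P}\}$ has one element. A $\mathcal P$-algebra $A$ has the distinguished element $1_A=\mu_0(0_{\mathcal P})$. An element $\theta\in\mathcal P(2)$ is an operation *for which $0_{\mathcal P}$ is a unit* if $\gamma(\theta;1_{\mathcal P},0_{\mathcal P})=1_{\mathcal P}=\gamma(\theta;0_{\mathcal P},1_{\mathcal P})$. For $m\ge 0$ let $F_{\mathcal P}(m)$ be the free $\mathcal P$-algebra on $\{1,\dots,m\}$, and $F(\mathcal P)$ the category with objects $0,1,2,\dots$ and $\mathrm{Hom}(k,l)=\mathrm{Hom}_{\mathcal P\text{-}Alg}(F_{\mathcal P}(k),F_{\mathcal P}(l))$. The set $\mathrm{Hom}(F_{\mathcal P}(m),A)$ is a $\mathcal P$-algebra by $\theta(f_1,\dots,f_k)(i)=\theta(f_1(i),\dots,f_k(i))$ for $1\le i\le m$, i.e. it is identified with the product algebra $A^m$. A *pointed algebraic theory* $\mathbb T$ is a category with objects $0,1,2,\dots$ in which $m$ is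 the $m$-th cartesian power of $1$ (with specified projections) and $0$ is a zero object. A $\mathbb T$-model is a functor $M:\mathbb T\to Set$ that preserves finite products; morphisms are natural transformations. The operad $\mathcal P_{\mathbb T}$ has $\mathcal P_{\mathbb T}(m)=\mathrm{Hom}_{\mathbb T}(m,1)$ and $\gamma(\theta;\theta_1,\dots,\theta_m)=\theta\circ(\theta_1\times\dots\times\theta_m)$; it is unitary. The forgetful functor $V:\mathbb T\text{-}Mod\to\mathcal P_{\mathbb T}\text{-}Alg$ sends $M$ to $M(1)$ with $\mathrm{Hom}_{\mathbb T}(m,1)$ acting on $M(1)^m\cong M(m)$. Let $F_{\mathbb T}(m)=\mathrm{Hom}_{\mathbb T}(m,-)$ be the free model on $m$ generators, and $F(\mathbb T)$ the category with objects $0,1,2,\dots$ and $\mathrm{Hom}(k,l)=\mathrm{Hom}_{\mathbb T\text{-}Mod}(F_{\mathbb T}(k),F_{\mathbb T}(l))$. As above $\mathrm{Hom}(F_{\mathbb T}(m),M)$ is a $\mathbb T$-model, corresponding to the product model $M^m$. For a $\mathcal P$-algebra $A$ let $I(A)=\ker(\mathbb Z[A]\to\mathbb Z)$ be the augmentation ideal;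 $\theta\in\mathcal P(m)$ induces $\bar\theta:\mathbb Z[A]^{\otimes m}\cong\mathbb Z[A^m]\to\mathbb Z[A]$. Put $I^n_{\mathcal P}(A)=\sum_{m\ge n}\sum_{\theta\in\mathcal P(m)}\bar\theta(I(A)^{\otimes m})$ and $P_n^{\mathcal P}(A)=I(A)/I_{\mathcal P}^{n+1}(A)$ (the generalized Passi functor), with $p_n(a)$ the class of $a-1_A$. Put $P_n^{\mathbb T}=P_n^{\mathcal P_{\mathbb T}}\circ V$. For a category $\mathcal C$ with zero morphisms and finite coproducts $\vee$ let $U_X:\mathcal C\to Ab$, $U_X(Y)=\mathbb Z[\mathcal C(X,Y)]/\mathbb Z[0]$. For $F:\mathcal C\to Ab$ the cross-effect $cr_{n}F(X_1,\dots,X_{n})\subset F(X_1\vee\dots\vee X_{n})$ is the intersection of the kernels of the maps to $F(X_1\vee\dots\widehat{X_k}\dots\vee X_{n})$, $1\le k\le n$, induced by the retractions, and $T_nF(X)$ is the cokernel of $cr_{n+1}F(X,\dots,X)\subset F(X\vee\dots\vee X)\to F(X)$, the last map being induced by the folding map. Let $t_n(f)\in T_nU_X(Y)$ be the class of $f:X\to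 Y$. The preadditive category $T_n\bar{\mathbb Z}[\mathcal C]$ has the objects of $\mathcal C$, $\mathrm{Hom}(X,Y)=T_nU_X(Y)$ and the bilinear composition with $t_n(g)\circ t_n(f)=t_n(g\circ f)$. **Theorem.** Let $n\ge 0$. (1) Let $\mathcal P$ be a unitary set-operad such that $\mathcal P(2)$ contains an operation for which $0_{\mathcal P}$ is a unit. Then: (a) For every $m\ge 1$ there is an isomorphism of functors $\mathcal P\text{-}Alg\to Ab$ $$T_nU_{F_{\mathcal P}(m)}\;\cong\;P_n^{\mathcal P}\circ\mathrm{Hom}_{\mathcal P\text{-}Alg}(F_{\mathcal P}(m),-),\qquad t_n(f)\mapsto p_n(f).$$ (b) There is a (necessarily unique) preadditive category $P_n^{\mathcal P}F(\mathcal P)$ with objects $0,1,2,\dots$, morphism groups $P_n^{\mathcal P}\big(\mathrm{Hom}(F_{\mathcal P}(k),F_{\mathcal P}(l))\big)$, identities $p_n(\mathrm{id})$ and composition satisfying $p_n(g)\circ p_n(f)=p_n(g\circ f)$; and there is an additive isomorphism of categories $T_n\bar{\mathbb Z}[F(\mathcal P)]\cong P_n^{\mathcal P}F(\mathcal P)$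 that is the identity on objects and sends $t_n(f)$ to $p_n(f)$. (2) Let $\mathbb T$ be a pointed algebraic theory such that $\mathcal P_{\mathbb T}(2)$ contains an operation for which $0_{\mathcal P_{\mathbb T}}$ is a unit. Then: (a) For every $m\ge 1$ there is an isomorphism of functors $\mathbb T\text{-}Mod\to Ab$ $$T_nU_{F_{\mathbb T}(m)}\;\cong\;P_n^{\mathbb T}\circ\mathrm{Hom}_{\mathbb T\text{-}Mod}(F_{\mathbb T}(m),-),\qquad t_n(f)\mapsto p_n(f).$$ (b) There is a (necessarily unique) preadditive category $P_n^{\mathbb T}F(\mathbb T)$ with objects $0,1,2,\dots$, morphism groups $P_n^{\mathbb T}\big(\mathrm{Hom}(F_{\mathbb T}(k),F_{\mathbb T}(l))\big)$, identities $p_n(\mathrm{id})$ and composition satisfying $p_n(g)\circ p_n(f)=p_n(g\circ f)$; and there is an additive isomorphism of categories $T_n\bar{\mathbb Z}[F(\mathbb T)]\cong P_n^{\mathbb T}F(\mathbb T)$ that is the identity on objects and sends $t_n(f)$ to $p_n(f)$. -/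

import Mathlib

open CategoryTheory CategoryTheory.Limits

universe u v w

theorem hasFiniteCoproducts_of_cofan {C : Type v} [Category.{w} C]
    (h : ∀ (n : ℕ) (A : Fin n → C), ∃ c : Cofan A, Nonempty (IsColimit c)) :
    HasFiniteCoproducts C where
  out n := by
    have : ∀ A : Fin n → C, HasCoproduct A := fun A =>
      let ⟨c, ⟨hc⟩⟩ := h n A
      ⟨⟨c, hc⟩⟩
    exact ⟨fun K => hasColimit_of_iso (Discrete.natIsoFunctor (F := K))⟩

/-- A full subcategory on objects `F m`, `m ∈ ℕ`, such that `Hom(F m, A)` is the `m`-th power of a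
functor `V` to sets, has finite coproducts. -/
theorem hasFiniteCoproducts_induced {D : Type v} [Category.{w} D] (F : ℕ → D) (V : D → Type u)
    (act : ∀ {A B : D}, (A ⟶ B) → V A → V B) (E : ∀ m A, (F m ⟶ A) ≃ (Fin m → V A))
    (hE : ∀ {m : ℕ} {A B : D} (f : F m ⟶ A) (g : A ⟶ B) (i : Fin m),
      E m B (f ≫ g) i = act g (E m A f i)) : HasFiniteCoproducts (InducedCategory D F) := by
  refine hasFiniteCoproducts_of_cofan fun r k => ?_
  have hE1 : ∀ {m : ℕ} {A : D} (f : F m ⟶ A) (i : Fin m), act f (E m _ (𝟙 (F m)) i) = E m A f i :=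
    fun f i => by rw [← hE, Category.id_comp]
  let N : InducedCategory D F := (∑ i, (k i : ℕ) : ℕ)
  let inj : ∀ i, F (k i) ⟶ F N := fun i =>
    (E _ _).symm fun j => E _ _ (𝟙 (F N)) (finSigmaFinEquiv ⟨i, j⟩)
  have hinj : ∀ {A : D} (f : F N ⟶ A) (i) (j : Fin (k i)),
      E _ _ (inj i ≫ f) j = E _ _ f (finSigmaFinEquiv ⟨i, j⟩) := fun f i j => by
    rw [hE, Equiv.apply_symm_apply, hE1]
  refine ⟨Cofan.mk N fun i => InducedCategory.homMk (inj i), ⟨Cofan.IsColimit.mk _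
    (fun s => InducedCategory.homMk ((E N (F s.pt)).symm fun t =>
      E _ _ (s.inj (finSigmaFinEquiv.symm t).1).hom (finSigmaFinEquiv.symm t).2)) ?_ ?_⟩⟩
  · intro s i
    refine InducedCategory.hom_ext ((E _ _).injective (funext fun j => ?_))
    refine (hinj _ i j).trans ?_
    refine (congrFun (Equiv.apply_symm_apply (E N (F s.pt)) _) _).trans ?_
    rw [Equiv.symm_apply_apply]
  · intro s m hm
    refine InducedCategory.hom_ext ((E _ _).injective (funext fun t => ?_))
    obtain ⟨⟨i, j⟩, rfl⟩ := finSigmaFinEquiv.surjective t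
    refine Eq.trans ?_ (congrFun (Equiv.apply_symm_apply (E N (F s.pt)) _) _).symm
    rw [Equiv.symm_apply_apply, ← hm]
    exact (hinj m.hom i j).symm

/-! ### Unitary symmetric set-operads -/

/-- Transport of operations along a bijection `e : {1, …, a} ≃ {1, …, b}` (so `a = b`), for a family
of sets with right actions of the symmetric groups: `relabel e θ = θ · e⁻¹`. -/
def relabel {Q : ℕ → Type u} (act : ∀ {n : ℕ}, Q n → Equiv.Perm (Fin n) → Q n) {a b : ℕ}
    (e : Fin a ≃ Fin b) (θ : Q a) : Q b :=
  have h : a = b := by simpa using Fintype.card_congr e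
  h ▸ act θ (e.trans (finCongr h.symm))⁻¹

/-- The permutation `(i, j) ↦ (i, τ i j)` of `{1, …, ∑ m i}`, that is, the block sum of the `τ i`. -/
def blockSum {n : ℕ} {m : Fin n → ℕ} (τ : ∀ i, Equiv.Perm (Fin (m i))) :
    Equiv.Perm (Fin (∑ i, m i)) :=
  (finSigmaFinEquiv.symm.trans (Equiv.sigmaCongrRight τ)).trans finSigmaFinEquiv

/-- The bijection that permutes blocks, `(i, j) ↦ (σ i, j)`. -/
def blockPerm {n : ℕ} (m : Fin n → ℕ) (σ : Equiv.Perm (Fin n)) :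
    Fin (∑ i, m (σ i)) ≃ Fin (∑ i, m i) :=
  (finSigmaFinEquiv.symm.trans (Equiv.sigmaCongrLeft (β := fun i => Fin (m i)) σ)).trans
    finSigmaFinEquiv

/-- A symmetric set-operad which is unitary, i.e. `P(0)` is a one-element set `{0_P}`.
Equations between operations whose arities agree only propositionally are stated in `Σ n, P(n)`. -/
structure UnitaryOperad where
  Op : ℕ → Type u
  act : ∀ {n : ℕ}, Op n → Equiv.Perm (Fin n) → Op n
  act_one : ∀ {n : ℕ} (θ : Op n), act θ 1 = θ
  act_mul : ∀ {n : ℕ} (θ : Op n) (σ τ : Equiv.Perm (Fin n)), act θ (σ * τ) = act (act θ σ) τ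
  one : Op 1
  γ : ∀ {n : ℕ} {m : Fin n → ℕ}, Op n → (∀ i, Op (m i)) → Op (∑ i, m i)
  one_γ : ∀ {m : ℕ} (φ : Op m),
    (⟨_, γ (m := fun _ => m) one fun _ => φ⟩ : Σ n, Op n) = ⟨m, φ⟩
  γ_one : ∀ {n : ℕ} (θ : Op n),
    (⟨_, γ θ fun _ => one⟩ : Σ n, Op n) = ⟨n, θ⟩
  γ_γ : ∀ {n : ℕ} {m : Fin n → ℕ} {l : ∀ i, Fin (m i) → ℕ} (θ : Op n) (φ : ∀ i, Op (m i))
    (ψ : ∀ i j, Op (l i j)),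
    (⟨_, γ (m := fun s => l (finSigmaFinEquiv.symm s).1 (finSigmaFinEquiv.symm s).2) (γ θ φ)
      fun s => ψ (finSigmaFinEquiv.symm s).1 (finSigmaFinEquiv.symm s).2⟩ : Σ n, Op n) =
      ⟨_, γ θ fun i => γ (φ i) (ψ i)⟩
  γ_act_right : ∀ {n : ℕ} {m : Fin n → ℕ} (θ : Op n) (φ : ∀ i, Op (m i))
    (τ : ∀ i, Equiv.Perm (Fin (m i))),
    γ θ (fun i => act (φ i) (τ i)) = act (γ θ φ) (blockSum τ)
  γ_act_left : ∀ {n : ℕ} {m : Fin n → ℕ} (θ : Op n) (φ : ∀ i, Op (m i)) (σ : Equiv.Perm (Fin n)),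
    γ (act θ σ) φ = relabel act (blockPerm m σ⁻¹) (γ θ fun i => φ (σ⁻¹ i))
  zero : Op 0
  eq_zero : ∀ θ : Op 0, θ = zero

namespace UnitaryOperad

/-- `θ ∈ P(2)` is an operation for which `0_P` is a unit: `γ(θ; 1_P, 0_P) = 1_P = γ(θ; 0_P, 1_P)`. -/
def IsUnital (P : UnitaryOperad.{u}) (θ : P.Op 2) : Prop :=
  (⟨_, P.γ θ fun i => ((![⟨1, P.one⟩, ⟨0, P.zero⟩] : Fin 2 → Σ n, P.Op n) i).2⟩ : Σ n, P.Op n) =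
      ⟨1, P.one⟩ ∧
    (⟨_, P.γ θ fun i => ((![⟨0, P.zero⟩, ⟨1, P.one⟩] : Fin 2 → Σ n, P.Op n) i).2⟩ : Σ n, P.Op n) =
      ⟨1, P.one⟩

end UnitaryOperad

/-! ### Algebras over an operad -/

/-- An algebra over the operad `P`: a set with operations `μ_n : P(n) × X^n → X` that are
equivariant (hence defined on `P(n) ×_{S_n} X^n`), unital and associative. -/
structure OpAlg (P : UnitaryOperad.{u}) where
  carrier : Type u
  op : ∀ {n : ℕ}, P.Op n → (Fin n → carrier) → carrier
  op_act : ∀ {n : ℕ} (θ : P.Op n) (σ : Equiv.Perm (Fin n)) (x : Fin n → carrier),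
    op (P.act θ σ) x = op θ fun i => x (σ⁻¹ i)
  op_one : ∀ x : Fin 1 → carrier, op P.one x = x 0
  op_γ : ∀ {n : ℕ} {m : Fin n → ℕ} (θ : P.Op n) (φ : ∀ i, P.Op (m i))
    (x : Fin (∑ i, m i) → carrier),
    op (P.γ θ φ) x = op θ fun i => op (φ i) fun j => x (finSigmaFinEquiv ⟨i, j⟩)

namespace OpAlg

variable {P : UnitaryOperad.{u}}

@[ext]
structure Hom (A B : OpAlg P) where
  toFun : A.carrier → B.carrier
  map_op : ∀ {n : ℕ} (θ : P.Op n) (x : Fin n → A.carrier),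
    toFun (A.op θ x) = B.op θ fun i => toFun (x i)

instance : Category (OpAlg P) where
  Hom := Hom
  id A := ⟨fun a => a, fun _ _ => rfl⟩
  comp f g := ⟨fun a => g.toFun (f.toFun a), fun θ x => by rw [f.map_op, g.map_op]⟩

@[ext]
theorem hom_ext {A B : OpAlg P} {f g : A ⟶ B} (h : ∀ a, f.toFun a = g.toFun a) : f = g :=
  Hom.ext (funext h)

@[simp]
theorem comp_toFun {A B C : OpAlg P} (f : A ⟶ B) (g : B ⟶ C) (a : A.carrier) :
    (f ≫ g).toFun a = g.toFun (f.toFun a) := rfl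

@[simp]
theorem id_toFun {A : OpAlg P} (a : A.carrier) : (𝟙 A : A ⟶ A).toFun a = a := rfl

/-- The element `1_A = μ_0(0_P)`. -/
def unit (A : OpAlg P) : A.carrier := A.op P.zero Fin.elim0

theorem op_unit (A : OpAlg P) {n : ℕ} (θ : P.Op n) : (A.op θ fun _ => A.unit) = A.unit := by
  have h := A.op_γ (m := fun _ => 0) θ (fun _ => P.zero) (fun s => (finSigmaFinEquiv.symm s).2.elim0)
  have h0 : ∀ x : Fin 0 → A.carrier, A.op P.zero x = A.unit := fun x => by
    rw [unit]; congr 1; exact Subsingleton.elim _ _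
  have h1 : ∀ (k : ℕ) (hk : k = 0) (φ : P.Op k) (x : Fin k → A.carrier), A.op φ x = A.unit := by
    rintro k rfl φ x; rw [P.eq_zero φ, h0]
  rw [h1 _ (by simp)] at h
  simp only [h0] at h
  exact h.symm

theorem map_unit {A B : OpAlg P} (f : A ⟶ B) : f.toFun A.unit = B.unit := by
  unfold unit; rw [f.map_op]; congr 1; exact Subsingleton.elim _ _

instance : HasZeroMorphisms (OpAlg P) where
  zero _ B := ⟨⟨fun _ => B.unit, fun θ _ => (B.op_unit θ).symm⟩⟩
  comp_zero _ _ := rfl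
  zero_comp _ _ _ f := hom_ext fun _ => map_unit f

/-! #### Algebras given by generators and relations -/

/-- Formal expressions built from the generators `X` and the operations of `P`. -/
inductive Term (P : UnitaryOperad.{u}) (X : Type u) : Type u
  | of (x : X) : Term P X
  | op {n : ℕ} (θ : P.Op n) (t : Fin n → Term P X) : Term P X

/-- The value of an expression in an algebra. -/
def Term.eval {X : Type u} (A : OpAlg P) (g : X → A.carrier) : Term P X → A.carrier
  | .of x => g x
  | .op θ t => A.op θ fun i => (t i).eval A g

theorem Term.eval_comp {X : Type u} {A B : OpAlg P} (f : A ⟶ B) (g : X → A.carrier)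
    (t : Term P X) : f.toFun (t.eval A g) = t.eval B fun x => f.toFun (g x) := by
  induction t with
  | of x => rfl
  | op θ t ih => simp only [eval, f.map_op, ih]

/-- Two expressions are identified if they have the same value in every algebra, under every
assignment of the generators that satisfies the relations `R`. -/
def presentedSetoid {X : Type u} (R : Term P X → Term P X → Prop) : Setoid (Term P X) where
  r s t := ∀ (A : OpAlg P) (g : X → A.carrier),
    (∀ a b, R a b → a.eval A g = b.eval A g) → s.eval A g = t.eval A g
  iseqv := ⟨fun _ _ _ _ => rfl, fun h A g hg => (h A g hg).symm,
    fun h k A g hg => (h A g hg).trans (k A g hg)⟩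

/-- The algebra with generators `X` and relations `R`. -/
noncomputable def presented {X : Type u} (R : Term P X → Term P X → Prop) : OpAlg P where
  carrier := Quotient (presentedSetoid R)
  op θ x := Quotient.mk _ (.op θ fun i => (x i).out)
  op_act θ σ x := Quotient.sound fun A g _ => A.op_act θ σ _
  op_one x := by
    conv_rhs => rw [← Quotient.out_eq (x 0)]
    exact Quotient.sound fun A g _ => A.op_one _
  op_γ θ φ x := by
    refine Quotient.sound fun A g hg => ?_
    refine (A.op_γ θ φ _).trans ?_
    simp only [Term.eval]
    congr 1
    funext i
    exact (Quotient.mk_out (s := presentedSetoid R)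
      (Term.op (φ i) fun j => (x (finSigmaFinEquiv ⟨i, j⟩)).out) A g hg).symm

def presented.of {X : Type u} (R : Term P X → Term P X → Prop) (x : X) : (presented R).carrier :=
  Quotient.mk (presentedSetoid R) (.of x)

theorem presented.mk_op {X : Type u} (R : Term P X → Term P X → Prop) {n : ℕ} (θ : P.Op n)
    (t : Fin n → Term P X) : (Quotient.mk (presentedSetoid R) (.op θ t) : (presented R).carrier) =
      (presented R).op θ fun i => Quotient.mk (presentedSetoid R) (t i) := by
  refine Quotient.sound fun A g hg => ?_
  simp only [Term.eval]
  congr 1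
  funext i
  exact (Quotient.mk_out (s := presentedSetoid R) (t i) A g hg).symm

theorem presented.mk_eq_eval {X : Type u} (R : Term P X → Term P X → Prop) (t : Term P X) :
    Quotient.mk (presentedSetoid R) t = t.eval (presented R) (presented.of R) := by
  induction t with
  | of x => rfl
  | op θ t ih =>
    rw [presented.mk_op]
    simp only [Term.eval]
    exact congrArg _ (funext ih)

theorem presented.rel {X : Type u} (R : Term P X → Term P X → Prop) {a b : Term P X} (h : R a b) :
    a.eval (presented R) (presented.of R) = b.eval (presented R) (presented.of R) := by
  rw [← presented.mk_eq_eval, ← presented.mk_eq_eval]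
  exact Quotient.sound fun A g hg => hg a b h

/-- The homomorphism from the presented algebra determined by the images of the generators. -/
def presented.desc {X : Type u} (R : Term P X → Term P X → Prop) (A : OpAlg P) (g : X → A.carrier)
    (hg : ∀ a b, R a b → a.eval A g = b.eval A g) : presented R ⟶ A where
  toFun := Quotient.lift (fun t => t.eval A g) fun _ _ h => h A g hg
  map_op θ x := by
    change (A.op θ fun i => ((x i).out).eval A g) = _
    congr 1
    funext i
    conv_rhs => rw [← Quotient.out_eq (x i)]
    rfl

@[simp]
theorem presented.desc_of {X : Type u} (R : Term P X → Term P X → Prop) (A : OpAlg P)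
    (g : X → A.carrier) (hg : ∀ a b, R a b → a.eval A g = b.eval A g) (x : X) :
    (presented.desc R A g hg).toFun (presented.of R x) = g x := rfl

theorem presented.ext {X : Type u} {R : Term P X → Term P X → Prop} {A : OpAlg P}
    {f g : presented R ⟶ A} (h : ∀ x, f.toFun (presented.of R x) = g.toFun (presented.of R x)) :
    f = g := by
  refine hom_ext fun a => ?_
  induction a using Quotient.inductionOn with
  | h t => rw [presented.mk_eq_eval, Term.eval_comp, Term.eval_comp]; simp only [h]

/-! #### Finite coproducts of algebras -/

/-- The relations that turn the maps `A i → A` into homomorphisms. -/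
inductive SumRel {ι : Type} (A : ι → OpAlg P) :
    Term P (Σ i, (A i).carrier) → Term P (Σ i, (A i).carrier) → Prop
  | mk (i : ι) {n : ℕ} (θ : P.Op n) (x : Fin n → (A i).carrier) :
    SumRel A (.of ⟨i, (A i).op θ x⟩) (.op θ fun j => .of ⟨i, x j⟩)

/-- The canonical maps into an algebra generated by the disjoint union of the `A i`, subject to at
least the relations `SumRel`. -/
def sumι {ι : Type} (A : ι → OpAlg P)
    (R : Term P (Σ i, (A i).carrier) → Term P (Σ i, (A i).carrier) → Prop)
    (hR : ∀ s t, SumRel A s t → R s t) (i : ι) : A i ⟶ presented R where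
  toFun a := presented.of _ ⟨i, a⟩
  map_op θ x := presented.rel R (hR _ _ (.mk i θ x))

/-- The homomorphism out of the coproduct with given components. -/
def sumDesc {ι : Type} (A : ι → OpAlg P) (B : OpAlg P) (f : ∀ i, A i ⟶ B) :
    presented (SumRel A) ⟶ B :=
  presented.desc _ B (fun x => (f x.1).toFun x.2) fun _ _ h => by
    cases h with
    | mk i θ x => exact (f i).map_op θ x

instance : HasFiniteCoproducts (OpAlg P) :=
  hasFiniteCoproducts_of_cofan fun n A =>
    ⟨Cofan.mk _ (sumι A (SumRel A) fun _ _ h => h), ⟨Cofan.IsColimit.mk _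
      (fun s => sumDesc A s.pt s.inj)
      (fun s i => rfl)
      (fun s m hm => presented.ext fun x => by
        exact congrArg (fun f => Hom.toFun f x.2) (hm x.1))⟩⟩

/-! #### Free algebras -/

/-- The free `P`-algebra on the set `X`. -/
noncomputable def free (P : UnitaryOperad.{u}) (X : Type u) : OpAlg P :=
  presented (P := P) (X := X) fun _ _ => False

/-- Homomorphisms out of the free algebra are determined by arbitrary values on the generators. -/
noncomputable def freeEquiv (X : Type u) (A : OpAlg P) : (free P X ⟶ A) ≃ (X → A.carrier) where
  toFun f x := f.toFun (presented.of _ x)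
  invFun g := presented.desc _ A g fun _ _ h => h.elim
  left_inv _ := presented.ext fun _ => rfl
  right_inv _ := rfl

/-- The free `P`-algebra `F_P(m)` on `m` generators. -/
noncomputable def freeFin (P : UnitaryOperad.{u}) (m : ℕ) : OpAlg P := free P (ULift.{u} (Fin m))

/-- The bijection `Hom(F_P(m), A) → A^m`, `f ↦ (f(1), …, f(m))`. -/
noncomputable def ev (m : ℕ) (A : OpAlg P) : (freeFin P m ⟶ A) ≃ (Fin m → A.carrier) :=
  (freeEquiv _ A).trans (Equiv.arrowCongr Equiv.ulift (Equiv.refl _))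

theorem ev_comp {m : ℕ} {A B : OpAlg P} (f : freeFin P m ⟶ A) (g : A ⟶ B) (i : Fin m) :
    ev m B (f ≫ g) i = g.toFun (ev m A f i) := rfl

/-- The algebra structure on `Hom(F_P(m), A)` that corresponds to the product algebra `A^m`:
`θ(f_1, …, f_k)` is the homomorphism with `θ(f_1, …, f_k)(i) = θ(f_1(i), …, f_k(i))`. -/
noncomputable def homAlg (m : ℕ) (A : OpAlg P) : OpAlg P where
  carrier := freeFin P m ⟶ A
  op θ f := (ev m A).symm fun i => A.op θ fun k => ev m A (f k) i
  op_act θ σ f := by simp only [A.op_act]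
  op_one f := by simp only [A.op_one, Equiv.symm_apply_apply]
  op_γ θ φ f := by simp only [A.op_γ, Equiv.apply_symm_apply]

/-- The functor `Hom(F_P(m), -)` with values in `P`-algebras. -/
noncomputable def homFunctor (P : UnitaryOperad.{u}) (m : ℕ) : OpAlg P ⥤ OpAlg P where
  obj A := homAlg m A
  map {A B} g :=
    { toFun := fun f => f ≫ g
      map_op := fun θ f => (ev m B).injective <| funext fun i => by
        simp only [homAlg, ev_comp, Equiv.apply_symm_apply, g.map_op]
        rfl }
  map_id _ := hom_ext fun _ => Category.comp_id _
  map_comp _ _ := hom_ext fun _ => (Category.assoc _ _ _).symm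

/-- The category `F(P)` with objects the natural numbers `m` (standing for `{1, …, m}`) and
`Hom(k, l) = Hom(F_P(k), F_P(l))`. -/
abbrev FreeCat (P : UnitaryOperad.{u}) : Type := InducedCategory (OpAlg P) (freeFin P)

noncomputable instance : HasZeroMorphisms (FreeCat P) where
  zero _ _ := ⟨InducedCategory.homMk 0⟩
  comp_zero f Z := InducedCategory.hom_ext (comp_zero (f := f.hom) (Z := freeFin P Z))
  zero_comp X _ _ f := InducedCategory.hom_ext (zero_comp (f := f.hom) (X := freeFin P X))

instance : HasFiniteCoproducts (FreeCat P) :=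
  hasFiniteCoproducts_induced (freeFin P) (fun A => A.carrier) (fun f => f.toFun) ev
    fun f g i => ev_comp f g i

end OpAlg

/-! ### Universal functors, cross-effects and Taylorisation -/

namespace PolyFunctor

variable {C : Type v} [Category.{u} C] [HasZeroMorphisms C]

/-- The universal functor `U_X : C → Ab`, `U_X(Y) = ℤ[Hom(X, Y)] / ℤ[0]`. -/
noncomputable def univFunctor (X : C) : C ⥤ AddCommGrpCat.{u} where
  obj Y := AddCommGrpCat.of
    (((X ⟶ Y) →₀ ℤ) ⧸ AddSubgroup.zmultiples (Finsupp.single (0 : X ⟶ Y) (1 : ℤ)))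
  map {Y Z} g := AddCommGrpCat.ofHom (QuotientAddGroup.map _ _
    (Finsupp.mapDomain.addMonoidHom fun f : X ⟶ Y => f ≫ g) (by
      rw [AddSubgroup.zmultiples_le]
      simp))
  map_id Y := by
    ext x
    simp
  map_comp g h := by
    ext x
    simp

/-- The class of a morphism `f` in `U_X(Y)`. -/
noncomputable def univMk {X Y : C} (f : X ⟶ Y) : (univFunctor X).obj Y :=
  QuotientAddGroup.mk (Finsupp.single f (1 : ℤ))

theorem univ_span (X Y : C) :
    AddSubgroup.closure (Set.range (univMk : (X ⟶ Y) → (univFunctor X).obj Y)) = ⊤ := by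
  rw [eq_top_iff]
  rintro x -
  obtain ⟨z, rfl⟩ := QuotientAddGroup.mk_surjective x
  induction z using Finsupp.induction_linear with
  | zero => exact zero_mem _
  | add a b ha hb => exact add_mem ha hb
  | single f c =>
    have : Finsupp.single f c = c • Finsupp.single f (1 : ℤ) := by simp
    rw [this]
    exact zsmul_mem (AddSubgroup.subset_closure (Set.mem_range_self f) :
      univMk f ∈ AddSubgroup.closure (Set.range (univMk : (X ⟶ Y) → (univFunctor X).obj Y))) c

theorem univ_hom_ext {X Y : C} {A : Type*} [AddGroup A] {f g : (univFunctor X).obj Y →+ A}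
    (h : ∀ a : X ⟶ Y, f (univMk a) = g (univMk a)) : f = g :=
  AddMonoidHom.eq_of_eqOn_dense (univ_span X Y) (by rintro _ ⟨a, rfl⟩; exact h a)

theorem univ_map_mk {X Y Z : C} (f : X ⟶ Y) (g : Y ⟶ Z) :
    ((univFunctor X).map g).hom (univMk f) = univMk (f ≫ g) :=
  congrArg QuotientAddGroup.mk Finsupp.mapDomain_single

theorem univMk_zero (X Y : C) : (univMk (0 : X ⟶ Y)) = 0 :=
  (QuotientAddGroup.eq_zero_iff _).2 (AddSubgroup.mem_zmultiples _)

/-- The map `U_Y(Z) → U_X(Z)`, `g ↦ g ∘ f`. -/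
noncomputable def univPreApp {X Y : C} (f : X ⟶ Y) (Z : C) :
    (univFunctor Y).obj Z ⟶ (univFunctor X).obj Z :=
  AddCommGrpCat.ofHom (QuotientAddGroup.map _ _
    (Finsupp.mapDomain.addMonoidHom fun g : Y ⟶ Z => f ≫ g) (by
      rw [AddSubgroup.zmultiples_le]
      simp))

theorem univPreApp_mk {X Y Z : C} (f : X ⟶ Y) (g : Y ⟶ Z) :
    (univPreApp f Z).hom (univMk g) = univMk (f ≫ g) :=
  congrArg QuotientAddGroup.mk Finsupp.mapDomain_single

/-- The natural transformation `f^* : U_Y → U_X`. -/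
noncomputable def univPre {X Y : C} (f : X ⟶ Y) : univFunctor Y ⟶ univFunctor X where
  app Z := univPreApp f Z
  naturality Z W g := AddCommGrpCat.hom_ext <| univ_hom_ext fun a => by
    rw [AddCommGrpCat.hom_comp, AddCommGrpCat.hom_comp, AddMonoidHom.comp_apply,
      AddMonoidHom.comp_apply, univ_map_mk, univPreApp_mk, univPreApp_mk, univ_map_mk,
      Category.assoc]

theorem univPre_mk {X Y Z : C} (f : X ⟶ Y) (g : Y ⟶ Z) :
    ((univPre f).app Z).hom (univMk g) = univMk (f ≫ g) :=
  univPreApp_mk f g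

section

variable [HasFiniteCoproducts C]

/-- The map `r_k : X_1 ∨ … ∨ X_n → X_1 ∨ … ∨ X̂_k ∨ … ∨ X_n` that is zero on `X_k` and the identity
on the other summands. -/
noncomputable def retract {n : ℕ} (X : Fin n → C) (k : Fin n) :
    (∐ X) ⟶ ∐ fun j : {j : Fin n // j ≠ k} => X j :=
  Sigma.desc fun j =>
    if h : j = k then 0 else Sigma.ι (fun j : {j : Fin n // j ≠ k} => X j) ⟨j, h⟩

/-- The cross-effect `cr_n F (X_1, …, X_n)`, as a subgroup of `F(X_1 ∨ … ∨ X_n)`: the kernel of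
the map to `⨁ k, F(X_1 ∨ … ∨ X̂_k ∨ … ∨ X_n)` with components `F(r_k)`. -/
noncomputable def crossEffect (F : C ⥤ AddCommGrpCat.{u}) {n : ℕ} (X : Fin n → C) :
    AddSubgroup (F.obj (∐ X)) :=
  ⨅ k, (F.map (retract X k)).hom.ker

/-- The folding map `X ∨ … ∨ X → X`. -/
noncomputable def fold (n : ℕ) (X : C) : (∐ fun _ : Fin n => X) ⟶ X :=
  Sigma.desc fun _ => 𝟙 X

/-- The image of `S_{n+1} : cr_{n+1} F (X, …, X) → F(X ∨ … ∨ X) → F(X)`. -/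
noncomputable def taylorKer (n : ℕ) (F : C ⥤ AddCommGrpCat.{u}) (X : C) : AddSubgroup (F.obj X) :=
  (crossEffect F fun _ : Fin (n + 1) => X).map (F.map (fold (n + 1) X)).hom

theorem taylorKer_natTrans (n : ℕ) {F G : C ⥤ AddCommGrpCat.{u}} (η : F ⟶ G) (X : C) :
    taylorKer n F X ≤ (taylorKer n G X).comap (η.app X).hom := by
  rintro _ ⟨x, hx, rfl⟩
  refine ⟨(η.app _).hom x, ?_, ?_⟩
  · simp only [crossEffect, SetLike.mem_coe, AddSubgroup.mem_iInf, AddMonoidHom.mem_ker] at hx ⊢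
    intro k
    have := ConcreteCategory.congr_hom (η.naturality (retract (fun _ : Fin (n + 1) => X) k)) x
    refine this.symm.trans ?_
    change (η.app _).hom ((F.map _).hom x) = 0
    rw [hx k, map_zero]
  · exact (ConcreteCategory.congr_hom (η.naturality (fold (n + 1) X)) x).symm

theorem taylorKer_map (n : ℕ) (F : C ⥤ AddCommGrpCat.{u}) {X Y : C} (f : X ⟶ Y) :
    taylorKer n F X ≤ (taylorKer n F Y).comap (F.map f).hom := by
  rintro _ ⟨x, hx, rfl⟩
  let g : (∐ fun _ : Fin (n + 1) => X) ⟶ ∐ fun _ : Fin (n + 1) => Y := Limits.Sigma.map fun _ => f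
  refine ⟨(F.map g).hom x, ?_, ?_⟩
  · simp only [crossEffect, SetLike.mem_coe, AddSubgroup.mem_iInf, AddMonoidHom.mem_ker] at hx ⊢
    intro k
    let g' : (∐ fun _ : {j : Fin (n + 1) // j ≠ k} => X) ⟶
      ∐ fun _ : {j : Fin (n + 1) // j ≠ k} => Y := Limits.Sigma.map fun _ => f
    have h : g ≫ retract (fun _ : Fin (n + 1) => Y) k =
        retract (fun _ : Fin (n + 1) => X) k ≫ g' := by
      refine Sigma.hom_ext _ _ fun j => ?_
      by_cases hj : j = k
      · simp [g, g', retract, hj]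
      · simp [g, g', retract, hj]
    have h2 := ConcreteCategory.congr_hom (congrArg F.map h) x
    rw [F.map_comp, F.map_comp] at h2
    refine h2.trans ?_
    change (F.map g').hom ((F.map _).hom x) = 0
    rw [hx k, map_zero]
  · have h : g ≫ fold (n + 1) Y = fold (n + 1) X ≫ f := by
      refine Sigma.hom_ext _ _ fun j => ?_
      simp [g, fold]
    have h2 := ConcreteCategory.congr_hom (congrArg F.map h) x
    rw [F.map_comp, F.map_comp] at h2
    exact h2

/-- The `n`-Taylorisation functor `T_n`: `T_n F = coker (S_{n+1} : (cr_{n+1} F) Δ → F)`. -/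
noncomputable def taylor (n : ℕ) : (C ⥤ AddCommGrpCat.{u}) ⥤ C ⥤ AddCommGrpCat.{u} where
  obj F :=
    { obj := fun X => AddCommGrpCat.of (F.obj X ⧸ taylorKer n F X)
      map := fun {X Y} f => AddCommGrpCat.ofHom
        (QuotientAddGroup.map _ _ (F.map f).hom (taylorKer_map n F f))
      map_id := fun X => by
        ext x
        simp
      map_comp := fun f g => by
        ext x
        simp }
  map {F G} η :=
    { app := fun X => AddCommGrpCat.ofHom
        (QuotientAddGroup.map _ _ (η.app X).hom (taylorKer_natTrans n η X))
      naturality := fun X Y f => by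
        ext x
        exact congrArg (QuotientAddGroup.mk (s := taylorKer n G Y))
          (ConcreteCategory.congr_hom (η.naturality f) x) }
  map_id F := by
    ext X x
    rfl
  map_comp η θ := by
    ext X x
    rfl

/-- The canonical epimorphism `t_n : F → T_n F`. -/
noncomputable def taylorMk (n : ℕ) (F : C ⥤ AddCommGrpCat.{u}) : F ⟶ (taylor n).obj F where
  app X := AddCommGrpCat.ofHom (QuotientAddGroup.mk' (taylorKer n F X))
  naturality _ _ _ := rfl

/-- The class `t_n(f)` of a morphism `f` in `T_n U_X (Y)`. -/
noncomputable def taylorClass (n : ℕ) {X Y : C} (f : X ⟶ Y) :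
    ((taylor n).obj (univFunctor X)).obj Y :=
  ((taylorMk n (univFunctor X)).app Y).hom (univMk f)

end
end PolyFunctor

/-! ### Preadditive categories generated by a category -/

/-- Abelian groups `N X Y` together with generating maps `p : Hom(X, Y) → N X Y`. -/
structure HomGroups (C : Type v) [Category.{u} C] where
  N : C → C → AddCommGrpCat.{u}
  p : ∀ {X Y : C}, (X ⟶ Y) → N X Y
  span : ∀ X Y : C, AddSubgroup.closure (Set.range (p : (X ⟶ Y) → N X Y)) = ⊤

namespace HomGroups

variable {C : Type v} [Category.{u} C]

theorem hom_ext (H : HomGroups C) {X Y : C} {A : Type*} [AddGroup A] {f g : H.N X Y →+ A}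
    (h : ∀ a : X ⟶ Y, f (H.p a) = g (H.p a)) : f = g :=
  AddMonoidHom.eq_of_eqOn_dense (H.span X Y) (by rintro _ ⟨a, rfl⟩; exact h a)

/-- A bilinear composition on the groups `N X Y` with `p(g) ∘ p(f) = p(g ∘ f)`. -/
structure Composition (H : HomGroups C) where
  comp : ∀ {X Y Z : C}, H.N X Y →+ H.N Y Z →+ H.N X Z
  comp_p : ∀ {X Y Z : C} (f : X ⟶ Y) (g : Y ⟶ Z), comp (H.p f) (H.p g) = H.p (f ≫ g)

/-- There is at most one such composition. -/
instance (H : HomGroups C) : Subsingleton H.Composition where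
  allEq K L := by
    have : @K.comp = @L.comp := by
      funext X Y Z
      exact H.hom_ext fun f => H.hom_ext fun g => by rw [K.comp_p, L.comp_p]
    cases K; cases L; cases this; rfl

variable {H : HomGroups C}

/-- The preadditive category with the objects of `C`, the morphism groups `N X Y`, and the given
composition. -/
structure Composition.Cat (K : H.Composition) where
  as : C

namespace Composition

variable (K : H.Composition)

noncomputable instance : Category.{u} K.Cat where
  Hom X Y := H.N X.as Y.as
  id X := H.p (𝟙 X.as)
  comp f g := K.comp f g
  id_comp {X Y} f := DFunLike.congr_fun (f := K.comp (H.p (𝟙 X.as))) (g := AddMonoidHom.id _)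
    (H.hom_ext fun a => by simp [K.comp_p]) f
  comp_id {X Y} f := DFunLike.congr_fun (f := K.comp.flip (H.p (𝟙 Y.as))) (g := AddMonoidHom.id _)
    (H.hom_ext fun a => by simp [K.comp_p]) f
  assoc {W X Y Z} f g h := by
    have e : ∀ (a : W.as ⟶ X.as) (b : X.as ⟶ Y.as),
        K.comp (K.comp (H.p a) (H.p b)) = (K.comp (H.p a)).comp (K.comp (Z := Z.as) (H.p b)) :=
      fun a b => H.hom_ext fun c => by simp [K.comp_p]
    have e2 : ∀ a : W.as ⟶ X.as, (K.comp.flip h).comp (K.comp (Z := Y.as) (H.p a)) =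
        (K.comp (H.p a)).comp (K.comp.flip h) :=
      fun a => H.hom_ext fun b => DFunLike.congr_fun (e a b) h
    have e3 : (K.comp.flip h).comp (K.comp.flip g) = K.comp.flip (K.comp g h) :=
      H.hom_ext fun a => DFunLike.congr_fun (e2 a) g
    exact DFunLike.congr_fun e3 f

theorem comp_add_left {X Y Z : C} (f g : H.N X Y) (h : H.N Y Z) :
    K.comp (f + g) h = K.comp f h + K.comp g h := by
  rw [map_add, AddMonoidHom.add_apply]

theorem comp_add_right {X Y Z : C} (f : H.N X Y) (g h : H.N Y Z) :
    K.comp f (g + h) = K.comp f g + K.comp f h :=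
  map_add _ _ _

noncomputable instance : Preadditive K.Cat where
  homGroup X Y := inferInstanceAs (AddCommGroup (H.N X.as Y.as))
  add_comp _ _ _ f g h := K.comp_add_left f g h
  comp_add _ _ _ f g h := K.comp_add_right f g h

/-- The functor that is the identity on objects and `f ↦ p(f)` on morphisms. -/
noncomputable def functor : C ⥤ K.Cat where
  obj X := ⟨X⟩
  map f := H.p f
  map_id _ := rfl
  map_comp f g := (K.comp_p f g).symm

end Composition

end HomGroups

/-! ### The category `T_n ℤ̄[C]` -/

namespace PolyFunctor

variable {C : Type v} [Category.{u} C] [HasZeroMorphisms C] [HasFiniteCoproducts C]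

theorem taylor_span (n : ℕ) (X Y : C) : AddSubgroup.closure (Set.range
    (taylorClass n : (X ⟶ Y) → ((taylor n).obj (univFunctor X)).obj Y)) = ⊤ := by
  have h : Set.range (taylorClass n : (X ⟶ Y) → _) =
      ((taylorMk n (univFunctor X)).app Y).hom '' Set.range univMk := by
    rw [← Set.range_comp]; rfl
  rw [h, ← AddMonoidHom.map_closure, univ_span, ← AddMonoidHom.range_eq_map,
    AddMonoidHom.range_eq_top]
  exact QuotientAddGroup.mk_surjective

/-- The groups `T_n U_X (Y)` with the maps `f ↦ t_n(f)`. -/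
noncomputable def taylorHoms (n : ℕ) (C : Type v) [Category.{u} C] [HasZeroMorphisms C]
    [HasFiniteCoproducts C] : HomGroups C where
  N X Y := ((taylor n).obj (univFunctor X)).obj Y
  p := taylorClass n
  span := taylor_span n

/-- The map `T_n U_Y(Z) → T_n U_X(Z)` induced by `f^*`. -/
noncomputable def taylorPre (n : ℕ) {X Y : C} (f : X ⟶ Y) (Z : C) :
    (taylorHoms n C).N Y Z →+ (taylorHoms n C).N X Z :=
  (((taylor n).map (univPre f)).app Z).hom

theorem taylorPre_p (n : ℕ) {X Y Z : C} (f : X ⟶ Y) (g : Y ⟶ Z) :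
    taylorPre n f Z ((taylorHoms n C).p g) = (taylorHoms n C).p (f ≫ g) :=
  congrArg ((taylorMk n (univFunctor X)).app Z).hom (univPre_mk f g)

theorem taylorHoms_zero (n : ℕ) (X Y : C) : (taylorHoms n C).p (0 : X ⟶ Y) = 0 :=
  (congrArg ((taylorMk n (univFunctor X)).app Y).hom (univMk_zero X Y)).trans (map_zero _)

/-- The bilinear map `U_X(Y) × T_n U_Y(Z) → T_n U_X(Z)` with `(f, t_n(g)) ↦ t_n(g ∘ f)`. -/
noncomputable def univComp (n : ℕ) (X Y Z : C) :
    (univFunctor X).obj Y →+ (taylorHoms n C).N Y Z →+ (taylorHoms n C).N X Z :=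
  QuotientAddGroup.lift _ (Finsupp.liftAddHom fun f : X ⟶ Y =>
      zmultiplesHom _ (taylorPre n f Z)) <| by
    rw [AddSubgroup.zmultiples_le]
    refine (taylorHoms n C).hom_ext fun g => ?_
    rw [Finsupp.liftAddHom_apply_single, zmultiplesHom_apply, one_zsmul, taylorPre_p, zero_comp,
      taylorHoms_zero]
    rfl

theorem univComp_mk (n : ℕ) {X Y Z : C} (f : X ⟶ Y) (g : Y ⟶ Z) :
    univComp n X Y Z (univMk f) ((taylorHoms n C).p g) = (taylorHoms n C).p (f ≫ g) := by
  have h : univComp n X Y Z (univMk f) = taylorPre n f Z := by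
    refine (Finsupp.liftAddHom_apply_single _ f (1 : ℤ)).trans ?_
    rw [zmultiplesHom_apply, one_zsmul]
  rw [h, taylorPre_p]

/-- The composition of `T_n ℤ̄[C]`, with `t_n(g) ∘ t_n(f) = t_n(g ∘ f)`. -/
noncomputable def taylorComp (n : ℕ) (C : Type v) [Category.{u} C] [HasZeroMorphisms C]
    [HasFiniteCoproducts C] : (taylorHoms n C).Composition where
  comp {X Y Z} := QuotientAddGroup.lift (taylorKer n (univFunctor X) Y) (univComp n X Y Z) <| by
    intro x hx
    refine (taylorHoms n C).hom_ext fun g => ?_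
    have h : (univComp n X Y Z).flip ((taylorHoms n C).p g) =
        (((taylorMk n (univFunctor X)).app Z).hom).comp ((univFunctor X).map g).hom :=
      univ_hom_ext fun f => (univComp_mk n f g).trans
        (congrArg ((taylorMk n (univFunctor X)).app Z).hom (univ_map_mk f g).symm)
    exact (DFunLike.congr_fun h x).trans
      ((QuotientAddGroup.eq_zero_iff _).2 (taylorKer_map n (univFunctor X) g hx))
  comp_p f g := univComp_mk n f g

/-- The preadditive category `T_n ℤ̄[C]`: same objects as `C`, `Hom(X, Y) = T_n U_X (Y)`. -/
abbrev TaylorCat (n : ℕ) (C : Type v) [Category.{u} C] [HasZeroMorphisms C]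
    [HasFiniteCoproducts C] : Type v := (taylorComp n C).Cat

end PolyFunctor

/-! ### Generalized Passi functors -/

namespace OpAlg

variable {P : UnitaryOperad.{u}}

open Classical in
/-- The operation `θ̄ : ℤ[A]^{⊗ m} → ℤ[A^m] → ℤ[A]` induced by `θ ∈ P(m)`, as a multilinear map; the
first map is the canonical isomorphism `a_1 ⊗ … ⊗ a_m ↦ (a_1, …, a_m)`. -/
noncomputable def zOp (A : OpAlg P) {m : ℕ} (θ : P.Op m) :
    MultilinearMap ℤ (fun _ : Fin m => A.carrier →₀ ℤ) (A.carrier →₀ ℤ) :=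
  ((Finsupp.lmapDomain ℤ ℤ (A.op θ)) ∘ₗ
    (PiTensorProduct.ofFinsuppEquiv' (R := ℤ) (κ := fun _ : Fin m => A.carrier)).toLinearMap
    ).compMultilinearMap (PiTensorProduct.tprod ℤ)

theorem zOp_single (A : OpAlg P) {m : ℕ} (θ : P.Op m) (a : Fin m → A.carrier) :
    (A.zOp θ fun i => Finsupp.single (a i) 1) = Finsupp.single (A.op θ a) 1 := by
  simp [zOp]

theorem zOp_mapDomain {A B : OpAlg P} (f : A ⟶ B) {m : ℕ} (θ : P.Op m)
    (x : Fin m → A.carrier →₀ ℤ) :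
    Finsupp.mapDomain f.toFun (A.zOp θ x) = B.zOp θ fun i => Finsupp.mapDomain f.toFun (x i) := by
  have h : (Finsupp.lmapDomain ℤ ℤ f.toFun).compMultilinearMap (A.zOp θ) =
      (B.zOp θ).compLinearMap fun _ => Finsupp.lmapDomain ℤ ℤ f.toFun := by
    refine Module.Basis.ext_multilinear (fun _ => Finsupp.basisSingleOne (R := ℤ)) fun a => ?_
    simp [zOp_single, f.map_op]
  exact DFunLike.congr_fun h x

/-- The augmentation `ε : ℤ[A] → ℤ`. -/
noncomputable def aug (A : OpAlg P) : (A.carrier →₀ ℤ) →+ ℤ :=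
  Finsupp.liftAddHom fun _ => AddMonoidHom.id ℤ

/-- The augmentation ideal `I(A) = ker ε`. -/
noncomputable def augIdeal (A : OpAlg P) : AddSubgroup (A.carrier →₀ ℤ) := A.aug.ker

/-- `I^n_P(A) = ∑_{m ≥ n} ∑_{θ ∈ P(m)} θ̄(I(A)^{⊗ m})`. -/
noncomputable def idealPow (A : OpAlg P) (n : ℕ) : AddSubgroup (A.carrier →₀ ℤ) :=
  AddSubgroup.closure {y | ∃ m, n ≤ m ∧ ∃ (θ : P.Op m) (x : Fin m → A.carrier →₀ ℤ),
    (∀ i, x i ∈ A.augIdeal) ∧ y = A.zOp θ x}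

theorem aug_mapDomain {A B : OpAlg P} (f : A ⟶ B) (x : A.carrier →₀ ℤ) :
    B.aug (Finsupp.mapDomain f.toFun x) = A.aug x := by
  have h : B.aug.comp (Finsupp.mapDomain.addMonoidHom f.toFun) = A.aug := by
    ext a
    simp [aug]
  exact DFunLike.congr_fun h x

/-- The map `I(A) → I(B)` induced by a homomorphism. -/
noncomputable def augMap {A B : OpAlg P} (f : A ⟶ B) : A.augIdeal →+ B.augIdeal :=
  ((Finsupp.mapDomain.addMonoidHom f.toFun).comp A.augIdeal.subtype).codRestrict B.augIdeal
    fun x => (aug_mapDomain f x.1).trans x.2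

theorem augMap_idealPow {A B : OpAlg P} (f : A ⟶ B) (n : ℕ) :
    (A.idealPow n).addSubgroupOf A.augIdeal ≤
      ((B.idealPow n).addSubgroupOf B.augIdeal).comap (augMap f) := by
  have h : A.idealPow n ≤ (B.idealPow n).comap (Finsupp.mapDomain.addMonoidHom f.toFun) := by
    rw [idealPow, AddSubgroup.closure_le]
    rintro _ ⟨m, hm, θ, x, hx, rfl⟩
    exact AddSubgroup.subset_closure ⟨m, hm, θ, _,
      fun i => (aug_mapDomain f (x i)).trans (hx i), zOp_mapDomain f θ x⟩
  exact fun x hx => h hx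

/-- The generalized Passi functor `P_n`, `P_n(A) = I(A) / I^{n+1}_P(A)`. -/
noncomputable def passi (P : UnitaryOperad.{u}) (n : ℕ) : OpAlg P ⥤ AddCommGrpCat.{u} where
  obj A := AddCommGrpCat.of (A.augIdeal ⧸ (A.idealPow (n + 1)).addSubgroupOf A.augIdeal)
  map f := AddCommGrpCat.ofHom (QuotientAddGroup.map _ _ (augMap f) (augMap_idealPow f (n + 1)))
  map_id A := by
    ext x
    refine congrArg QuotientAddGroup.mk (Subtype.ext ?_)
    exact Finsupp.mapDomain_id
  map_comp f g := by
    ext x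
    refine congrArg QuotientAddGroup.mk (Subtype.ext ?_)
    exact Finsupp.mapDomain_comp (M := ℤ) (f := f.toFun) (g := g.toFun)

/-- The element `a - 1_A` of `I(A)`. -/
noncomputable def augMk (A : OpAlg P) (a : A.carrier) : A.augIdeal :=
  ⟨Finsupp.single a 1 - Finsupp.single A.unit 1, by
    rw [augIdeal, AddMonoidHom.mem_ker, map_sub]; simp [aug]⟩

/-- The quotient map `q_n : I(A) → P_n(A)`. -/
noncomputable def passiQuot (n : ℕ) (A : OpAlg P) : A.augIdeal →+ (passi P n).obj A :=
  QuotientAddGroup.mk' _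

/-- The class `p_n(a) = q_n(a - 1_A)` of an element `a` of `A` in `P_n(A)`. -/
noncomputable def passiMk (n : ℕ) (A : OpAlg P) (a : A.carrier) : (passi P n).obj A :=
  passiQuot n A (A.augMk a)

theorem aug_span (A : OpAlg P) : AddSubgroup.closure (Set.range A.augMk) = ⊤ := by
  have h : ∀ z : A.carrier →₀ ℤ, ∃ y ∈ AddSubgroup.closure (Set.range A.augMk),
      z - Finsupp.single A.unit (A.aug z) = y := by
    intro z
    induction z using Finsupp.induction_linear with
    | zero => exact ⟨0, zero_mem _, by simp⟩
    | add a b ha hb =>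
      obtain ⟨y, hy, e⟩ := ha
      obtain ⟨y', hy', e'⟩ := hb
      refine ⟨y + y', add_mem hy hy', ?_⟩
      rw [map_add, Finsupp.single_add, AddSubgroup.coe_add, ← e, ← e']
      abel
    | single a c =>
      refine ⟨c • A.augMk a, zsmul_mem (AddSubgroup.subset_closure (Set.mem_range_self a)) c, ?_⟩
      simp [augMk, aug, smul_sub]
  rw [eq_top_iff]
  rintro ⟨z, hz⟩ -
  obtain ⟨y, hy, e⟩ := h z
  have hz' : A.aug z = 0 := hz
  rw [hz', Finsupp.single_zero, sub_zero] at e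
  have : (⟨z, hz⟩ : A.augIdeal) = y := Subtype.ext e
  rwa [this]

theorem passi_span (n : ℕ) (A : OpAlg P) :
    AddSubgroup.closure (Set.range (passiMk n A)) = ⊤ := by
  have h : Set.range (passiMk n A) = passiQuot n A '' Set.range A.augMk := by
    rw [← Set.range_comp]; rfl
  rw [h, ← AddMonoidHom.map_closure, aug_span, ← AddMonoidHom.range_eq_map,
    AddMonoidHom.range_eq_top]
  exact QuotientAddGroup.mk_surjective

/-- The groups `P_n(Hom(F_P(k), F_P(l)))` with the maps `f ↦ p_n(f)`. -/
noncomputable def passiHoms (P : UnitaryOperad.{u}) (n : ℕ) : HomGroups (FreeCat P) where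
  N k l := (passi P n).obj (homAlg k (freeFin P l))
  p {k l} f := passiMk n (homAlg k (freeFin P l)) f.hom
  span k l := by
    rw [← passi_span]
    congr 1
    ext y
    exact ⟨fun ⟨f, h⟩ => ⟨f.hom, h⟩, fun ⟨f, h⟩ => ⟨InducedCategory.homMk f, h⟩⟩

end OpAlg

/-! ### Pointed algebraic theories -/

/-- A pointed algebraic theory: a category with objects `0, 1, 2, …` in which `m` is the `m`-th
cartesian power of `1`, with chosen projections `proj i : m → 1` (the identity for `m = 1`), and
`0` is a zero object. The field `tuple` is the universal property of the power; as `0` is the empty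
power it is terminal, so that it only remains to require that it is initial. -/
structure PointedTheory where
  Hom : ℕ → ℕ → Type u
  id : ∀ m, Hom m m
  comp : ∀ {k l m}, Hom k l → Hom l m → Hom k m
  id_comp : ∀ {k l} (f : Hom k l), comp (id k) f = f
  comp_id : ∀ {k l} (f : Hom k l), comp f (id l) = f
  assoc : ∀ {j k l m} (f : Hom j k) (g : Hom k l) (h : Hom l m),
    comp (comp f g) h = comp f (comp g h)
  proj : ∀ {m}, Fin m → Hom m 1
  tuple : ∀ {k m}, (Fin m → Hom k 1) → Hom k m
  tuple_proj : ∀ {k m} (f : Fin m → Hom k 1) (i : Fin m), comp (tuple f) (proj i) = f i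
  hom_ext : ∀ {k m} {f g : Hom k m}, (∀ i : Fin m, comp f (proj i) = comp g (proj i)) → f = g
  proj_one : ∀ i : Fin 1, proj i = id 1
  zero : ∀ m, Hom 0 m
  eq_zero : ∀ {m} (f : Hom 0 m), f = zero m

/-- `finSigmaFinEquiv` is the lexicographic enumeration. -/
theorem finSigmaFinEquiv_lt {n : ℕ} {m : Fin n → ℕ} {p q : Σ i, Fin (m i)}
    (h : p.1 < q.1 ∨ p.1 = q.1 ∧ (p.2 : ℕ) < q.2) :
    finSigmaFinEquiv p < finSigmaFinEquiv q := by
  obtain ⟨i, j⟩ := p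
  obtain ⟨i', j'⟩ := q
  rw [Fin.lt_def, finSigmaFinEquiv_apply, finSigmaFinEquiv_apply]
  rcases h with h | ⟨e, h⟩
  · simp only at h ⊢
    let M : ℕ → ℕ := fun t => if h : t < n then m ⟨t, h⟩ else 0
    have hM : ∀ a : Fin n, ∑ k : Fin a, m (Fin.castLE a.2.le k) = ∑ t ∈ Finset.range a, M t := by
      intro a
      rw [Finset.sum_range]
      refine Finset.sum_congr rfl fun k _ => ?_
      simp only [M]
      rw [dif_pos (k.2.trans a.2)]
      rfl
    rw [hM, hM]
    have h1 : ∑ t ∈ Finset.range (i + 1), M t ≤ ∑ t ∈ Finset.range i', M t :=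
      Finset.sum_le_sum_of_subset (Finset.range_subset_range.2 h)
    rw [Finset.sum_range_succ] at h1
    have h2 : M i = m i := dif_pos i.2
    have := j.2
    omega
  · simp only at e h ⊢
    subst e
    omega

theorem lex_of_finSigmaFinEquiv_lt {n : ℕ} {m : Fin n → ℕ} {p q : Σ i, Fin (m i)}
    (h : finSigmaFinEquiv p < finSigmaFinEquiv q) :
    p.1 < q.1 ∨ p.1 = q.1 ∧ (p.2 : ℕ) < q.2 := by
  by_contra hc
  push Not at hc
  rcases hc.1.lt_or_eq with h1 | h1
  · exact absurd h (finSigmaFinEquiv_lt (Or.inl h1)).not_gt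
  · rcases (hc.2 h1.symm).lt_or_eq with h2 | h2
    · exact absurd h (finSigmaFinEquiv_lt (Or.inr ⟨h1, h2⟩)).not_gt
    · obtain ⟨i, j⟩ := p
      obtain ⟨i', j'⟩ := q
      simp only at h1 h2
      subst h1
      rw [Fin.ext h2] at h
      exact lt_irrefl _ h

theorem sum_finSigmaFinEquiv {n : ℕ} {m : Fin n → ℕ} (l : ∀ i, Fin (m i) → ℕ) :
    ∑ s, l (finSigmaFinEquiv.symm s).1 (finSigmaFinEquiv.symm s).2 = ∑ i, ∑ j, l i j := by
  rw [Equiv.sum_comp finSigmaFinEquiv.symm fun p : Σ i, Fin (m i) => l p.1 p.2, Fintype.sum_sigma]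

theorem finSigmaFinEquiv_nested_lt {n : ℕ} {m : Fin n → ℕ} (l : ∀ i, Fin (m i) → ℕ)
    (p q : Σ i, Fin (m i)) (k : Fin (l p.1 p.2)) (k' : Fin (l q.1 q.2))
    (h : finSigmaFinEquiv p < finSigmaFinEquiv q) :
    finSigmaFinEquiv (n := fun i => ∑ j, l i j) ⟨p.1, finSigmaFinEquiv ⟨p.2, k⟩⟩ <
      finSigmaFinEquiv (n := fun i => ∑ j, l i j) ⟨q.1, finSigmaFinEquiv ⟨q.2, k'⟩⟩ := by
  rcases lex_of_finSigmaFinEquiv_lt h with h1 | ⟨h1, h2⟩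
  · exact finSigmaFinEquiv_lt (Or.inl h1)
  · refine finSigmaFinEquiv_lt (Or.inr ⟨h1, ?_⟩)
    obtain ⟨i, j⟩ := p
    obtain ⟨i', j'⟩ := q
    simp only at h1 h2
    subst h1
    exact finSigmaFinEquiv_lt (Or.inl h2)

theorem finSigmaFinEquiv_assoc {n : ℕ} {m : Fin n → ℕ} (l : ∀ i, Fin (m i) → ℕ)
    (x : Σ s, Fin (l (finSigmaFinEquiv.symm s).1 (finSigmaFinEquiv.symm s).2)) :
    finSigmaFinEquiv x = Fin.cast (sum_finSigmaFinEquiv l).symm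
      (finSigmaFinEquiv ⟨(finSigmaFinEquiv.symm x.1).1,
        finSigmaFinEquiv ⟨(finSigmaFinEquiv.symm x.1).2, x.2⟩⟩) := by
  let K : (Σ s, Fin (l (finSigmaFinEquiv.symm s).1 (finSigmaFinEquiv.symm s).2)) → Fin _ :=
    fun x => Fin.cast (sum_finSigmaFinEquiv l).symm
      (finSigmaFinEquiv ⟨(finSigmaFinEquiv.symm x.1).1,
        finSigmaFinEquiv ⟨(finSigmaFinEquiv.symm x.1).2, x.2⟩⟩)
  let g : Fin _ → Fin _ := fun t => K (finSigmaFinEquiv.symm t)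
  have hK : ∀ x, g (finSigmaFinEquiv x) = K x := fun x =>
    congrArg K (finSigmaFinEquiv.symm_apply_apply x)
  have hg : StrictMono g := by
    intro t t' htt
    obtain ⟨⟨s, k⟩, rfl⟩ := finSigmaFinEquiv.surjective t
    obtain ⟨⟨s', k'⟩, rfl⟩ := finSigmaFinEquiv.surjective t'
    rw [hK, hK, Fin.cast_lt_cast]
    rcases lex_of_finSigmaFinEquiv_lt htt with h | ⟨h, h'⟩
    · exact finSigmaFinEquiv_nested_lt l _ _ k k' (by simpa using h)
    · simp only at h h'
      subst h
      refine finSigmaFinEquiv_lt (Or.inr ⟨rfl, ?_⟩)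
      exact finSigmaFinEquiv_lt (Or.inr ⟨rfl, h'⟩)
  have h := le_antisymm (hg.le_apply (x := finSigmaFinEquiv x)) hg.apply_le
  exact h.trans (hK x)

namespace PointedTheory

variable (T : PointedTheory.{u})

theorem comp_tuple {j k m : ℕ} (f : T.Hom j k) (g : Fin m → T.Hom k 1) :
    T.comp f (T.tuple g) = T.tuple fun i => T.comp f (g i) :=
  T.hom_ext fun i => by rw [T.assoc, T.tuple_proj, T.tuple_proj]

theorem tuple_proj_self {k m : ℕ} (f : T.Hom k m) : (T.tuple fun i => T.comp f (T.proj i)) = f :=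
  T.hom_ext fun i => by rw [T.tuple_proj]

theorem tuple_id {m : ℕ} : T.tuple T.proj = T.id m :=
  T.hom_ext fun i => by rw [T.tuple_proj, T.id_comp]

/-- The morphism `θ_1 × … × θ_m` followed by `θ`. -/
def γ {n : ℕ} {m : Fin n → ℕ} (θ : T.Hom n 1) (φ : ∀ i, T.Hom (m i) 1) : T.Hom (∑ i, m i) 1 :=
  T.comp (T.tuple fun i => T.comp (T.tuple fun j => T.proj (finSigmaFinEquiv ⟨i, j⟩)) (φ i)) θ

/-- The right action of `S_n` on `Hom(n, 1)` induced by the left action on `n = 1^n`. -/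
def act {n : ℕ} (θ : T.Hom n 1) (σ : Equiv.Perm (Fin n)) : T.Hom n 1 :=
  T.comp (T.tuple fun i => T.proj (σ⁻¹ i)) θ

theorem relabel_act {a b : ℕ} (e : Fin a ≃ Fin b) (θ : T.Hom a 1) :
    relabel (Q := fun n => T.Hom n 1) T.act e θ = T.comp (T.tuple fun i => T.proj (e i)) θ := by
  obtain rfl : a = b := by simpa using Fintype.card_congr e
  rfl

theorem sigma_ext {a b : ℕ} (h : a = b) {f : T.Hom a 1} {g : T.Hom b 1}
    (e : f = T.comp (T.tuple fun i => T.proj (Fin.cast h.symm i)) g) :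
    (⟨a, f⟩ : Σ n, T.Hom n 1) = ⟨b, g⟩ := by
  subst h
  rw [e]
  have : (fun i : Fin a => T.proj (Fin.cast rfl i)) = T.proj := rfl
  rw [this, T.tuple_id, T.id_comp]

theorem γ_γ {n : ℕ} {m : Fin n → ℕ} {l : ∀ i, Fin (m i) → ℕ} (θ : T.Hom n 1)
    (φ : ∀ i, T.Hom (m i) 1) (ψ : ∀ i j, T.Hom (l i j) 1) :
    (⟨_, T.γ (m := fun s => l (finSigmaFinEquiv.symm s).1 (finSigmaFinEquiv.symm s).2) (T.γ θ φ)
      fun s => ψ (finSigmaFinEquiv.symm s).1 (finSigmaFinEquiv.symm s).2⟩ : Σ n, T.Hom n 1) =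
      ⟨_, T.γ θ fun i => T.γ (φ i) (ψ i)⟩ := by
  refine T.sigma_ext (sum_finSigmaFinEquiv l) ?_
  let G : (Σ i, Fin (m i)) → T.Hom _ 1 := fun p =>
    T.comp (T.tuple fun k => T.proj (Fin.cast (sum_finSigmaFinEquiv l).symm
      (finSigmaFinEquiv (n := fun i => ∑ j, l i j) ⟨p.1, finSigmaFinEquiv ⟨p.2, k⟩⟩))) (ψ p.1 p.2)
  have hG : ∀ s, T.comp (T.tuple fun k => T.proj (finSigmaFinEquiv ⟨s, k⟩))
      (ψ (finSigmaFinEquiv.symm s).1 (finSigmaFinEquiv.symm s).2) = G (finSigmaFinEquiv.symm s) := by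
    intro s
    simp only [G]
    congr 2
    funext k
    rw [finSigmaFinEquiv_assoc l ⟨s, k⟩]
  unfold γ
  simp only [hG, ← T.assoc, T.comp_tuple, T.tuple_proj, Equiv.symm_apply_apply]
  simp only [G]

/-- The unitary set-operad `P_T` with `P_T(m) = Hom(m, 1)`. -/
def operad : UnitaryOperad.{u} where
  Op m := T.Hom m 1
  act := T.act
  act_one θ := by
    change T.comp (T.tuple T.proj) θ = θ
    rw [T.tuple_id, T.id_comp]
  act_mul θ σ τ := by
    simp only [act, ← T.assoc, T.comp_tuple, T.tuple_proj, mul_inv_rev]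
    rfl
  one := T.id 1
  γ := T.γ
  one_γ {m} φ := by
    refine T.sigma_ext (by simp) ?_
    rw [γ, T.comp_id, ← T.comp_id (T.tuple _), ← T.proj_one 0, T.tuple_proj]
    congr 2
    funext j
    congr 1
    ext
    rw [finSigmaFinEquiv_one]
    rfl
  γ_one {n} θ := by
    refine T.sigma_ext (by simp) ?_
    rw [γ]
    congr 2
    funext i
    rw [← T.proj_one 0, T.tuple_proj]
    congr 1
    ext
    rw [finSigmaFinEquiv_apply]
    simp
  γ_γ := T.γ_γ
  γ_act_right θ φ τ := by
    simp only [act, γ, ← T.assoc, T.comp_tuple, T.tuple_proj]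
    congr
    funext i
    congr
    funext j
    congr 1
    rw [eq_comm, Equiv.Perm.inv_eq_iff_eq]
    simp [blockSum]
  γ_act_left θ φ σ := by
    rw [T.relabel_act]
    simp only [act, γ, ← T.assoc, T.comp_tuple, T.tuple_proj]
    congr
    funext i
    congr
    funext j
    congr 1
    simp [blockPerm]
  zero := T.zero 1
  eq_zero := T.eq_zero

end PointedTheory

/-! ### Models of a pointed algebraic theory -/

namespace PointedTheory

/-- The objects `0, 1, 2, …` of the theory. -/
structure Obj (T : PointedTheory.{u}) where
  n : ℕ

instance (T : PointedTheory.{u}) : Category.{u} T.Obj where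
  Hom X Y := T.Hom X.n Y.n
  id X := T.id X.n
  comp f g := T.comp f g
  id_comp f := T.id_comp f
  comp_id f := T.comp_id f
  assoc f g h := T.assoc f g h

/-- The category of `T`-models: functors from the theory to sets that preserve finite products. -/
abbrev Model (T : PointedTheory.{u}) : Type (u + 1) :=
  ObjectProperty.FullSubcategory fun M : T.Obj ⥤ Type u => PreservesFiniteProducts M

variable {T : PointedTheory.{u}}

/-- The projection `proj i : k → 1` as a morphism of the category. -/
def pr {k : ℕ} (i : Fin k) : (⟨k⟩ : T.Obj) ⟶ ⟨1⟩ := T.proj i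

theorem bijective_of_preserves (M : T.Obj ⥤ Type u) [PreservesFiniteProducts M] (k : ℕ) :
    Function.Bijective fun (x : M.obj ⟨k⟩) (i : Fin k) => M.map (T.pr i) x := by
  let c : Fan fun _ : Fin k => (⟨1⟩ : T.Obj) := Fan.mk ⟨k⟩ fun i => T.pr i
  have hc : IsLimit c := Fan.IsLimit.mk c (fun s => T.tuple fun i => s.proj i)
    (fun s i => T.tuple_proj _ i)
    (fun s m h => T.hom_ext fun i => (h i).trans (T.tuple_proj _ i).symm)
  have h := (Types.isLimit_iff _).1 ⟨isLimitOfPreserves M hc⟩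
  refine Function.bijective_iff_existsUnique _ |>.2 fun y => ?_
  obtain ⟨x, hx, hu⟩ := h (fun i => y i.as) (by
    rintro ⟨i⟩ ⟨j⟩ ⟨⟨e⟩⟩
    simp only at e
    subst e
    exact ConcreteCategory.congr_hom
      ((Discrete.functor (fun _ : Fin k => (⟨1⟩ : T.Obj)) ⋙ M).map_id ⟨i⟩) _)
  exact ⟨x, funext fun i => hx ⟨i⟩, fun z hz => hu z fun i => congrFun hz i.as⟩

theorem preserves_of_bijective (M : T.Obj ⥤ Type u)
    (h : ∀ k, Function.Bijective fun (x : M.obj ⟨k⟩) (i : Fin k) => M.map (T.pr i) x) :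
    PreservesFiniteProducts M where
  preserves r := by
    refine ⟨fun {K} => ?_⟩
    suffices ∀ f : Fin r → T.Obj, PreservesLimit (Discrete.functor f) M from
      preservesLimit_of_iso_diagram M (Discrete.natIsoFunctor (F := K)).symm
    intro f
    let c : Fan f := Fan.mk ⟨∑ i, (f i).n⟩ fun i =>
      T.tuple fun j => T.proj (finSigmaFinEquiv ⟨i, j⟩)
    have hc : IsLimit c := Fan.IsLimit.mk c
      (fun s => T.tuple fun t => T.comp (s.proj (finSigmaFinEquiv.symm t).1)
        (T.proj (finSigmaFinEquiv.symm t).2))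
      (fun s i => T.hom_ext fun j => (T.assoc _ _ _).trans <| by
        change T.comp _ (T.comp (T.tuple _) _) = _
        rw [T.tuple_proj, T.tuple_proj, Equiv.symm_apply_apply])
      (fun s m hm => T.hom_ext fun t => by
        obtain ⟨⟨i, j⟩, rfl⟩ := finSigmaFinEquiv.surjective t
        rw [T.tuple_proj, Equiv.symm_apply_apply]
        refine Eq.trans ?_ (congrArg (fun q => T.comp q (T.proj j)) (hm i))
        refine Eq.trans ?_ (T.assoc _ _ _).symm
        change _ = T.comp _ (T.comp (T.tuple _) _)
        rw [T.tuple_proj])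
    refine preservesLimit_of_preserves_limit_cone hc ?_
    refine Nonempty.some ((Types.isLimit_iff _).2 fun s _ => ?_)
    have key : ∀ (x : M.obj ⟨∑ i, (f i).n⟩) (i : Fin r) (j : Fin (f i).n),
        M.map (T.pr j) (M.map (c.proj i) x) = M.map (T.pr (finSigmaFinEquiv ⟨i, j⟩)) x := by
      intro x i j
      have e : c.proj i ≫ T.pr j = T.pr (finSigmaFinEquiv ⟨i, j⟩) := T.tuple_proj _ j
      rw [← e, M.map_comp]
      rfl
    obtain ⟨x, hx⟩ := (h (∑ i, (f i).n)).2 fun t =>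
      M.map (T.pr (finSigmaFinEquiv.symm t).2) (s ⟨(finSigmaFinEquiv.symm t).1⟩)
    refine ⟨x, ?_, fun y hy => (h _).1 (funext fun t => ?_)⟩
    · rintro ⟨i⟩
      refine (h (f i).n).1 (funext fun j => ?_)
      refine (key x i j).trans ((congrFun hx _).trans ?_)
      rw [Equiv.symm_apply_apply]
    · obtain ⟨⟨i, j⟩, rfl⟩ := finSigmaFinEquiv.surjective t
      refine (key y i j).symm.trans (Eq.trans ?_ (congrFun hx _).symm)
      rw [Equiv.symm_apply_apply]
      exact congrArg (M.map (T.pr j)) (hy ⟨i⟩)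

namespace Model

/-- The isomorphism `M(k) ≅ M(1)^k`. -/
noncomputable def pow (M : T.Model) (k : ℕ) : M.obj.obj ⟨k⟩ ≃ (Fin k → M.obj.obj ⟨1⟩) :=
  have := M.property
  Equiv.ofBijective _ (bijective_of_preserves M.obj k)

theorem pow_apply (M : T.Model) {k : ℕ} (x : M.obj.obj ⟨k⟩) (i : Fin k) :
    M.pow k x i = M.obj.map (T.pr i) x := rfl

theorem map_pow_symm (M : T.Model) {k : ℕ} (i : Fin k) (x : Fin k → M.obj.obj ⟨1⟩) :
    M.obj.map (T.pr i) ((M.pow k).symm x) = x i := by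
  rw [← pow_apply, Equiv.apply_symm_apply]

/-- The action of `θ : k → 1` on `M(1)^k ≅ M(k)`. -/
noncomputable def op (M : T.Model) {k : ℕ} (θ : T.Hom k 1) (x : Fin k → M.obj.obj ⟨1⟩) :
    M.obj.obj ⟨1⟩ :=
  M.obj.map (X := ⟨k⟩) (Y := ⟨1⟩) θ ((M.pow k).symm x)

theorem op_proj (M : T.Model) {k : ℕ} (i : Fin k) (x : Fin k → M.obj.obj ⟨1⟩) :
    M.op (T.proj i) x = x i :=
  M.map_pow_symm i x

theorem map_eq (M : T.Model) {k l : ℕ} (f : T.Hom k l) (x : Fin k → M.obj.obj ⟨1⟩) :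
    M.obj.map (X := ⟨k⟩) (Y := ⟨l⟩) f ((M.pow k).symm x) =
      (M.pow l).symm fun i => M.op (T.comp f (T.proj i)) x := by
  rw [Equiv.eq_symm_apply]
  funext i
  exact (ConcreteCategory.congr_hom (M.obj.map_comp (X := ⟨k⟩) (Y := ⟨l⟩) f (T.pr i)) _).symm

theorem op_comp (M : T.Model) {k l : ℕ} (f : T.Hom k l) (θ : T.Hom l 1)
    (x : Fin k → M.obj.obj ⟨1⟩) :
    M.op (T.comp f θ) x = M.op θ fun i => M.op (T.comp f (T.proj i)) x :=
  (ConcreteCategory.congr_hom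
    (M.obj.map_comp (X := ⟨k⟩) (Y := ⟨l⟩) (Z := ⟨1⟩) f θ) _).trans
      (congrArg (M.obj.map (X := ⟨l⟩) (Y := ⟨1⟩) θ) (M.map_eq f x))

end Model

/-- The algebra over `P_T` given by a set on which the morphisms `k → 1` act as operations,
compatibly with the composition and the projections of the theory. -/
def mkAlg (X : Type u) (op : ∀ {k : ℕ}, T.Hom k 1 → (Fin k → X) → X)
    (op_comp : ∀ {k l : ℕ} (f : T.Hom k l) (θ : T.Hom l 1) (x : Fin k → X),
      op (T.comp f θ) x = op θ fun i => op (T.comp f (T.proj i)) x)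
    (op_proj : ∀ {k : ℕ} (i : Fin k) (x : Fin k → X), op (T.proj i) x = x i) :
    OpAlg T.operad where
  carrier := X
  op θ x := op θ x
  op_act θ σ x := by
    refine (op_comp _ _ _).trans ?_
    simp only [T.tuple_proj, op_proj]
  op_one x := by
    refine (congrArg (fun f => op f x) (T.proj_one 0).symm).trans (op_proj 0 x)
  op_γ θ φ x := by
    refine (op_comp _ _ _).trans (congrArg (op θ) (funext fun i => ?_))
    rw [T.tuple_proj]
    refine (op_comp _ _ _).trans ?_
    simp only [T.tuple_proj, op_proj]

/-- The forgetful functor from `T`-models to `P_T`-algebras, `M ↦ M(1)`. -/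
noncomputable def forget (T : PointedTheory.{u}) : T.Model ⥤ OpAlg T.operad where
  obj M := mkAlg (M.obj.obj ⟨1⟩) M.op M.op_comp M.op_proj
  map {M N} f :=
    { toFun := fun a => f.hom.app ⟨1⟩ a
      map_op := fun {k} θ x => by
        have h := ConcreteCategory.congr_hom (f.hom.naturality (X := ⟨k⟩) (Y := ⟨1⟩) θ)
          ((M.pow k).symm x)
        refine h.trans (congrArg (N.obj.map (X := ⟨k⟩) (Y := ⟨1⟩) θ) ?_)
        refine ((N.pow k).symm_apply_eq.2 (funext fun i => ?_)).symm
        refine Eq.trans ?_ (ConcreteCategory.congr_hom (f.hom.naturality (T.pr i)) _)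
        exact congrArg (f.hom.app ⟨1⟩) (M.map_pow_symm i x).symm }
  map_id M := OpAlg.hom_ext fun _ => rfl
  map_comp f g := OpAlg.hom_ext fun _ => rfl

/-- A homomorphism of the underlying algebras is a morphism of models. -/
noncomputable def homOfAlg {M N : T.Model} (g : (forget T).obj M ⟶ (forget T).obj N) : M ⟶ N :=
  ObjectProperty.homMk
    { app := fun X => ↾fun x => (N.pow X.n).symm fun i => g.toFun (M.pow X.n x i)
      naturality := fun X Y f => by
        ext x
        obtain ⟨x, rfl⟩ := (M.pow X.n).symm.surjective x
        change (N.pow Y.n).symm (fun i => g.toFun (M.pow Y.n (M.obj.map f ((M.pow X.n).symm x)) i)) =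
          N.obj.map f ((N.pow X.n).symm fun i => g.toFun (M.pow X.n ((M.pow X.n).symm x) i))
        have h1 := M.map_eq (k := X.n) (l := Y.n) f x
        have h2 := N.map_eq (k := X.n) (l := Y.n) f fun i => g.toFun (x i)
        rw [Equiv.apply_symm_apply]
        refine Eq.trans ?_ h2.symm
        refine congrArg _ (funext fun i => ?_)
        refine (congrArg (fun y => g.toFun (M.pow Y.n y i)) h1).trans ?_
        rw [Equiv.apply_symm_apply]
        exact g.map_op _ _ }

theorem forget_map_homOfAlg {M N : T.Model} (g : (forget T).obj M ⟶ (forget T).obj N) :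
    (forget T).map (homOfAlg g) = g := by
  refine OpAlg.hom_ext fun a => ?_
  have h : ∀ (M : T.Model) (a : M.obj.obj ⟨1⟩), M.pow 1 a = fun _ => a := fun M a => funext fun i => by
    rw [Model.pow_apply]
    have : T.pr i = 𝟙 (⟨1⟩ : T.Obj) := T.proj_one i
    rw [this, M.obj.map_id]
    rfl
  change (N.pow 1).symm (fun i => g.toFun (M.pow 1 a i)) = g.toFun a
  exact (N.pow 1).symm_apply_eq.2
    ((congrArg (fun q i => g.toFun (q i)) (h M a)).trans (h N (g.toFun a)).symm)

theorem forget_injective {M N : T.Model} {f g : M ⟶ N} (h : (forget T).map f = (forget T).map g) :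
    f = g := by
  refine ObjectProperty.hom_ext _ (NatTrans.ext (funext fun X => ?_))
  ext x
  refine (N.pow X.n).injective (funext fun i => ?_)
  refine (ConcreteCategory.congr_hom (f.hom.naturality (T.pr i)) x).symm.trans ?_
  refine Eq.trans ?_ (ConcreteCategory.congr_hom (g.hom.naturality (T.pr i)) x)
  exact congrArg (fun q => q.toFun (M.obj.map (T.pr i) x)) h

/-- An algebra over `P_T` comes from a model if and only if its operations are compatible with the
composition and the projections of the theory. -/
structure IsModel (A : OpAlg T.operad) : Prop where
  op_comp : ∀ {k l : ℕ} (f : T.Hom k l) (θ : T.Hom l 1) (x : Fin k → A.carrier),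
    A.op (n := k) (T.comp f θ) x = A.op (n := l) θ fun i => A.op (n := k) (T.comp f (T.proj i)) x
  op_proj : ∀ {k : ℕ} (i : Fin k) (x : Fin k → A.carrier), A.op (n := k) (T.proj i) x = x i

theorem forget_isModel (M : T.Model) : IsModel ((forget T).obj M) :=
  ⟨M.op_comp, M.op_proj⟩

theorem IsModel.op_comp_proj {A : OpAlg T.operad} (hA : IsModel A) {k : ℕ} (i : Fin k) (j : Fin 1)
    (x : Fin k → A.carrier) : A.op (n := k) (T.comp (T.proj i) (T.proj j)) x = x i := by
  rw [T.proj_one, T.comp_id, hA.op_proj]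

/-- The model `k ↦ A^k`. -/
def ofAlg (A : OpAlg T.operad) (hA : IsModel A) : T.Model where
  obj :=
    { obj := fun X => Fin X.n → A.carrier
      map := fun {X Y} f => ↾fun x i => A.op (n := X.n) (T.comp f (T.proj i)) x
      map_id := fun X => by
        ext x i
        refine (congrArg (fun f => A.op (n := X.n) f x) (T.id_comp (T.proj i))).trans ?_
        exact hA.op_proj i x
      map_comp := fun {X Y Z} f g => by
        ext x i
        refine (congrArg (fun f => A.op (n := X.n) f x) (T.assoc f g (T.proj i))).trans ?_
        exact hA.op_comp f _ x }
  property := preserves_of_bijective _ fun k => by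
    refine ⟨fun x y e => funext fun i => ?_, fun y => ⟨fun i => y i 0, ?_⟩⟩
    · have e' := congrFun (congrFun e i) 0
      exact (hA.op_comp_proj i 0 x).symm.trans (e'.trans (hA.op_comp_proj i 0 y))
    · funext i j
      refine (hA.op_comp_proj i j _).trans ?_
      rw [Subsingleton.elim j 0]

/-- The morphism of models induced by a homomorphism. -/
def ofAlgMap {A B : OpAlg T.operad} (g : A ⟶ B) (hA : IsModel A) (hB : IsModel B) :
    ofAlg A hA ⟶ ofAlg B hB :=
  ObjectProperty.homMk
    { app := fun X => ↾fun x i => g.toFun (x i)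
      naturality := fun X Y f => by
        ext x
        exact funext fun i : Fin Y.n => g.map_op (n := X.n) (T.comp f (T.proj i)) x }

theorem op_ofAlg (A : OpAlg T.operad) (hA : IsModel A) {k : ℕ} (θ : T.Hom k 1)
    (x : Fin k → Fin 1 → A.carrier) (j : Fin 1) :
    (ofAlg A hA).op θ x j = A.op (n := k) θ fun i => x i 0 := by
  have h : ((ofAlg A hA).pow k).symm x = fun i => x i 0 := by
    refine ((ofAlg A hA).pow k).symm_apply_eq.2 (funext fun i => funext fun j => ?_)
    refine Eq.trans ?_ (hA.op_comp_proj i j _).symm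
    rw [Subsingleton.elim j 0]
  refine (congrArg (fun y => (ofAlg A hA).obj.map (X := ⟨k⟩) (Y := ⟨1⟩) θ y j) h).trans ?_
  change A.op (n := k) (T.comp θ (T.proj j)) _ = _
  rw [T.proj_one, T.comp_id]

/-- The underlying algebra of the model `k ↦ A^k` is `A`. -/
def ofAlgHom (A : OpAlg T.operad) (hA : IsModel A) : A ⟶ (forget T).obj (ofAlg A hA) where
  toFun a := fun _ => a
  map_op θ x := funext fun j => (op_ofAlg A hA θ (fun i _ => x i) j).symm

def ofAlgInv (A : OpAlg T.operad) (hA : IsModel A) : (forget T).obj (ofAlg A hA) ⟶ A where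
  toFun a := a 0
  map_op θ x := op_ofAlg A hA θ x 0

theorem ofAlg_inv_hom (A : OpAlg T.operad) (hA : IsModel A) : ofAlgInv A hA ≫ ofAlgHom A hA = 𝟙 _ :=
  OpAlg.hom_ext fun a => funext fun j => congrArg a (Subsingleton.elim 0 j)

noncomputable instance : HasZeroMorphisms T.Model where
  zero M N := ⟨homOfAlg 0⟩
  comp_zero f N := forget_injective (by
    rw [Functor.map_comp]
    refine (congrArg _ (forget_map_homOfAlg 0)).trans ?_
    rw [comp_zero]
    exact (forget_map_homOfAlg 0).symm)
  zero_comp M _ _ f := forget_injective (by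
    rw [Functor.map_comp]
    refine (congrArg (· ≫ _) (forget_map_homOfAlg 0)).trans ?_
    refine zero_comp.trans ?_
    exact (forget_map_homOfAlg 0).symm)

/-- The relations that define the coproduct of models. -/
inductive ModelRel {ι : Type} (A : ι → OpAlg T.operad) :
    OpAlg.Term T.operad (Σ i, (A i).carrier) → OpAlg.Term T.operad (Σ i, (A i).carrier) → Prop
  | sum {s t} (h : OpAlg.SumRel A s t) : ModelRel A s t
  | comp {k l : ℕ} (f : T.Hom k l) (θ : T.Hom l 1)
      (t : Fin k → OpAlg.Term T.operad (Σ i, (A i).carrier)) :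
    ModelRel A (.op (n := k) (T.comp f θ) t)
      (.op (n := l) θ fun i => .op (n := k) (T.comp f (T.proj i)) t)
  | proj {k : ℕ} (i : Fin k) (t : Fin k → OpAlg.Term T.operad (Σ i, (A i).carrier)) :
    ModelRel A (.op (n := k) (T.proj i) t) (t i)

theorem isModel_presented {ι : Type} (A : ι → OpAlg T.operad) :
    IsModel (OpAlg.presented (ModelRel A)) := by
  have h : ∀ {k : ℕ} (x : Fin k → (OpAlg.presented (ModelRel A)).carrier),
      ∃ t : Fin k → OpAlg.Term T.operad (Σ i, (A i).carrier),
        x = fun i => (t i).eval (OpAlg.presented (ModelRel A)) (OpAlg.presented.of (ModelRel A)) :=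
    fun x => ⟨fun i => (x i).out, funext fun i => by
      rw [← OpAlg.presented.mk_eq_eval]
      exact (Quotient.out_eq (x i)).symm⟩
  refine ⟨fun f θ x => ?_, fun i x => ?_⟩
  · obtain ⟨t, rfl⟩ := h x
    exact OpAlg.presented.rel _ (ModelRel.comp f θ t)
  · obtain ⟨t, rfl⟩ := h x
    exact OpAlg.presented.rel _ (ModelRel.proj i t)

instance : HasFiniteCoproducts T.Model :=
  hasFiniteCoproducts_of_cofan fun n M => by
    let A : Fin n → OpAlg T.operad := fun i => (forget T).obj (M i)
    let S := OpAlg.presented (ModelRel A)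
    have hS : IsModel S := isModel_presented A
    let ι : ∀ i, A i ⟶ S := OpAlg.sumι A (ModelRel A) fun _ _ h => .sum h
    let desc : ∀ (N : T.Model), (∀ i, M i ⟶ N) → (S ⟶ (forget T).obj N) := fun N f =>
      OpAlg.presented.desc _ _ (fun x => ((forget T).map (f x.1)).toFun x.2) fun _ _ h => by
        cases h with
        | sum h =>
          cases h with
          | mk i θ x => exact ((forget T).map (f i)).map_op θ x
        | comp f θ t => exact (forget_isModel N).op_comp f θ _
        | proj i t => exact (forget_isModel N).op_proj i _
    refine ⟨Cofan.mk (ofAlg S hS) fun i => homOfAlg (ι i ≫ ofAlgHom S hS), ⟨Cofan.IsColimit.mk _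
      (fun s => homOfAlg (ofAlgInv S hS ≫ desc s.pt s.inj)) ?_ ?_⟩⟩
    · intro s i
      refine forget_injective ?_
      refine ((forget T).map_comp _ _).trans ?_
      refine (congrArg₂ (· ≫ ·) (forget_map_homOfAlg _) (forget_map_homOfAlg _)).trans ?_
      rfl
    · intro s m hm
      refine forget_injective ?_
      refine Eq.trans ?_ (forget_map_homOfAlg _).symm
      have h : ofAlgHom S hS ≫ (forget T).map m = desc s.pt s.inj := by
        refine OpAlg.presented.ext fun x => ?_
        have := congrArg (fun q => ((forget T).map q).toFun x.2) (hm x.1)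
        refine Eq.trans ?_ this
        have h2 := congrArg (fun q => ((forget T).map m).toFun (q.toFun x.2))
          (forget_map_homOfAlg (ι x.1 ≫ ofAlgHom S hS))
        exact h2.symm
      rw [← h, ← Category.assoc, ofAlg_inv_hom]
      exact (Category.id_comp _).symm

/-- The free model `F_T(m) = Hom_T(m, -)` on `m` generators. -/
def freeModel (T : PointedTheory.{u}) (m : ℕ) : T.Model where
  obj := coyoneda.obj (.op ⟨m⟩)
  property := inferInstance

theorem freeModel_app {m : ℕ} {M : T.Model} (f : freeModel T m ⟶ M) (i : Fin m) :
    f.hom.app ⟨1⟩ (T.proj i) = M.pow m (f.hom.app ⟨m⟩ (T.id m)) i := by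
  refine Eq.trans ?_ (ConcreteCategory.congr_hom (f.hom.naturality (T.pr i)) (T.id m))
  exact congrArg (f.hom.app ⟨1⟩) (T.id_comp (T.proj i)).symm

/-- The bijection `Hom(F_T(m), M) → M(1)^m`, `f ↦ (f(1), …, f(m))`, where the `i`-th generator is
`proj i ∈ Hom_T(m, 1)`. -/
noncomputable def ev (m : ℕ) (M : T.Model) :
    (freeModel T m ⟶ M) ≃ (Fin m → M.obj.obj ⟨1⟩) :=
  Equiv.ofBijective (fun f i => f.hom.app ⟨1⟩ (T.proj i)) <| by
    refine ⟨fun f g h => ?_, fun x => ⟨ObjectProperty.homMk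
      (coyonedaEquiv.symm ((M.pow m).symm x)), funext fun i => M.map_pow_symm i x⟩⟩
    refine ObjectProperty.hom_ext _ (coyonedaEquiv.injective ((M.pow m).injective ?_))
    funext i
    exact (freeModel_app f i).symm.trans ((congrFun h i).trans (freeModel_app g i))

theorem ev_comp {m : ℕ} {M N : T.Model} (f : freeModel T m ⟶ M) (g : M ⟶ N) (i : Fin m) :
    ev m N (f ≫ g) i = g.hom.app ⟨1⟩ (ev m M f i) := rfl

/-- The structure on `Hom(F_T(m), M)` that corresponds to the product `M(1)^m`: `θ(f_1, …, f_k)` is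
the morphism with `θ(f_1, …, f_k)(i) = θ(f_1(i), …, f_k(i))`. -/
noncomputable def homOp (m : ℕ) (M : T.Model) {k : ℕ} (θ : T.Hom k 1)
    (f : Fin k → (freeModel T m ⟶ M)) : freeModel T m ⟶ M :=
  (ev m M).symm fun i => M.op θ fun j => ev m M (f j) i

theorem homOp_comp (m : ℕ) (M : T.Model) {k l : ℕ} (f : T.Hom k l) (θ : T.Hom l 1)
    (x : Fin k → (freeModel T m ⟶ M)) :
    homOp m M (T.comp f θ) x = homOp m M θ fun i => homOp m M (T.comp f (T.proj i)) x := by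
  simp only [homOp, Equiv.apply_symm_apply, M.op_comp f θ]

theorem homOp_proj (m : ℕ) (M : T.Model) {k : ℕ} (i : Fin k)
    (x : Fin k → (freeModel T m ⟶ M)) : homOp m M (T.proj i) x = x i := by
  simp only [homOp, M.op_proj, Equiv.symm_apply_apply]

theorem homOp_postcomp (m : ℕ) {M N : T.Model} {k : ℕ} (θ : T.Hom k 1)
    (f : Fin k → (freeModel T m ⟶ M)) (g : M ⟶ N) :
    homOp m M θ f ≫ g = homOp m N θ fun j => f j ≫ g := by
  refine (ev m N).injective (funext fun i => ?_)
  rw [ev_comp, homOp, homOp, Equiv.apply_symm_apply, Equiv.apply_symm_apply]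
  exact ((forget T).map g).map_op θ _

/-- The functor `Hom(F_T(m), -)` with values in `T`-models. -/
noncomputable def homFunctor (T : PointedTheory.{u}) (m : ℕ) : T.Model ⥤ T.Model where
  obj M := ofAlg (mkAlg (freeModel T m ⟶ M) (homOp m M) (homOp_comp m M) (homOp_proj m M))
    ⟨homOp_comp m M, homOp_proj m M⟩
  map {M N} g := ofAlgMap
    { toFun := fun f => f ≫ g
      map_op := fun θ f => homOp_postcomp m θ f g } _ _
  map_id M := by
    refine ObjectProperty.hom_ext _ (NatTrans.ext (funext fun X => ?_))
    ext x
    exact funext fun i : Fin X.n => Category.comp_id (x i)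
  map_comp f g := by
    refine ObjectProperty.hom_ext _ (NatTrans.ext (funext fun X => ?_))
    ext x
    exact funext fun i : Fin X.n => (Category.assoc (x i) f g).symm

/-- The category `F(T)` with objects the natural numbers `m` (standing for `{1, …, m}`) and
`Hom(k, l) = Hom(F_T(k), F_T(l))`. -/
abbrev FreeCat (T : PointedTheory.{u}) : Type := InducedCategory T.Model (freeModel T)

noncomputable instance : HasZeroMorphisms (FreeCat T) where
  zero _ _ := ⟨InducedCategory.homMk 0⟩
  comp_zero f Z := InducedCategory.hom_ext (comp_zero (f := f.hom) (Z := freeModel T Z))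
  zero_comp X _ _ f := InducedCategory.hom_ext (zero_comp (f := f.hom) (X := freeModel T X))

instance : HasFiniteCoproducts (FreeCat T) :=
  hasFiniteCoproducts_induced (freeModel T) (fun M => M.obj.obj ⟨1⟩) (fun f => f.hom.app ⟨1⟩) ev
    fun f g i => ev_comp f g i

/-- The functor `P_n^T = P_n^{P_T} ∘ V`, where `V` is the forgetful functor. -/
noncomputable def passi (T : PointedTheory.{u}) (n : ℕ) : T.Model ⥤ AddCommGrpCat.{u} :=
  forget T ⋙ OpAlg.passi T.operad n

/-- The class `p_n(a)` of `a ∈ M(1)` in `P_n^T(M)`. -/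
noncomputable def passiMk (n : ℕ) (M : T.Model) (a : M.obj.obj ⟨1⟩) : (passi T n).obj M :=
  OpAlg.passiMk n ((forget T).obj M) a

/-- The class `p_n(f)` of a morphism `f` in `P_n^T(Hom(F_T(m), M))`. -/
noncomputable def passiHom (n : ℕ) {m : ℕ} {M : T.Model} (f : freeModel T m ⟶ M) :
    (passi T n).obj ((homFunctor T m).obj M) :=
  passiMk n ((homFunctor T m).obj M) fun _ => f

/-- The groups `P_n^T(Hom(F_T(k), F_T(l)))` with the maps `f ↦ p_n(f)`. -/
noncomputable def passiHoms (T : PointedTheory.{u}) (n : ℕ) : HomGroups (FreeCat T) where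
  N k l := (passi T n).obj ((homFunctor T k).obj (freeModel T l))
  p {k l} f := passiHom n f.hom
  span k l := by
    refine Eq.trans ?_ (OpAlg.passi_span n ((forget T).obj ((homFunctor T k).obj (freeModel T l))))
    congr 1
    ext y
    exact ⟨fun ⟨f, h⟩ => ⟨fun _ => f.hom, h⟩, fun ⟨f, h⟩ => ⟨InducedCategory.homMk (f 0),
      (congrArg (passiMk n ((homFunctor T k).obj (freeModel T l)))
        (funext fun i => congrArg f (Subsingleton.elim 0 i))).trans h⟩⟩

end PointedTheory

/-! All four statements reduce to one. Let `X` be an object of a category with zero morphisms and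
finite coproducts, and let `H` be a functor to `P`-algebras with natural bijections `Hom(X, Y) ≅
H(Y)` taking `0` to the distinguished element (`AlgRepresentation`). Then `f ↦ f - 1` identifies
`U_X(Y)` with the augmentation ideal `I(H(Y))` (`augEquiv`). It remains to see that the folded
cross-effect, which `T_n` divides out, becomes the `(n+1)`-st ideal power (`map_taylorKer`).

One inclusion holds for every such `H` (`idealPow_le`). Given `θ̄(x_1, …, x_k)` with `k ≥ n + 1` and
all `x_i` in the ideal, distribute the inputs surjectively over the `n + 1` summands of `Y ∨ … ∨ Y`
and apply `θ̄` there. Killing a summand kills some input, so the result is in the cross-effect, and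
folding gives back the given element.

The other inclusion (`augEquiv_mem_idealPow`) needs the algebra `H(Y ∨ … ∨ Y)` to be generated by
the images of the summands (`GeneratesSums`). Its group ring is then spanned by values of operations
on augmentation ideals of summands. If `q_k` kills the `k`-th summand, then `1 - q_k` fixes a
cross-effect element, whereas it keeps those spanning elements in which summand `k` occurs and kills
the others. Hence a cross-effect element is a sum of terms in which all `n + 1` summands occur.
These have arity at least `n + 1`, and folding sends them into the ideal power.

The operation with unit `0_P` serves to prove generation. A sum of algebras, of models or of free
objects is always generated by its summands, but here `H(Y)` is the power `A^m`. A tuple is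
assembled by the unital operation from tuples with a single nontrivial coordinate, for which
generation is inherited from `A` (`GeneratesSums.pow`). Part (b) then follows by transporting the
composition along the isomorphisms of morphism groups. -/

namespace OpAlg

variable {P : UnitaryOperad.{u}}

/-! ### Inserting units into operations, and the augmentation -/

theorem op_eq_unit (A : OpAlg P) {q : Σ n, P.Op n} (hq : q = ⟨0, P.zero⟩)
    (x : Fin q.1 → A.carrier) : A.op q.2 x = A.unit := by
  subst hq
  exact congrArg (A.op P.zero) (Subsingleton.elim _ _)

/-- An equation in `Σ n, P(n)` replaces arity and operation simultaneously. Only the common value of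
the inputs is prescribed, so no input family has to be transported between arities. -/
theorem op_eq_of_one (A : OpAlg P) {q : Σ n, P.Op n} (hq : q = ⟨1, P.one⟩) {b : A.carrier}
    {x : Fin q.1 → A.carrier} (hx : ∀ j, x j = b) : A.op q.2 x = b := by
  subst hq
  exact (A.op_one x).trans (hx 0)

/-- Evaluate `γ(θ; 1_P, 0_P) = 1_P` at the input `a` in two ways. -/
theorem op_unital_left (A : OpAlg P) {θ : P.Op 2} (hθ : P.IsUnital θ) (a : A.carrier) :
    A.op θ ![a, A.unit] = a := by
  have h := A.op_eq_of_one hθ.1 (b := a) (x := fun _ => a) fun _ => rfl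
  refine Eq.trans ?_ h
  rw [A.op_γ]
  congr 1
  funext i
  fin_cases i
  · exact (A.op_eq_of_one rfl fun _ => rfl).symm
  · exact (A.op_eq_unit rfl _).symm

theorem op_unital_right (A : OpAlg P) {θ : P.Op 2} (hθ : P.IsUnital θ) (a : A.carrier) :
    A.op θ ![A.unit, a] = a := by
  have h := A.op_eq_of_one hθ.2 (b := a) (x := fun _ => a) fun _ => rfl
  refine Eq.trans ?_ h
  rw [A.op_γ]
  congr 1
  funext i
  fin_cases i
  · exact (A.op_eq_unit rfl _).symm
  · exact (A.op_eq_of_one rfl fun _ => rfl).symm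

/-- Inserting `0_P` into some of the inputs of an operation. -/
theorem exists_op_insert_unit {k : ℕ} (θ : P.Op k) (p : Fin k → Prop) [DecidablePred p] :
    ∃ (r : ℕ) (θ' : P.Op r) (e : Fin r ≃ {i // p i}),
      ∀ (A : OpAlg P) (a : {i // p i} → A.carrier),
        (A.op θ' fun t => a (e t)) = A.op θ fun i => if h : p i then a ⟨i, h⟩ else A.unit := by
  -- The operation plugged into input `i` of `θ`: the identity where `p` holds, the nullary
  -- operation elsewhere.
  let q : Fin k → Σ n, P.Op n := fun i => if p i then ⟨1, P.one⟩ else ⟨0, P.zero⟩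
  have q1 : ∀ {i}, p i → q i = ⟨1, P.one⟩ := fun h => if_pos h
  have q0 : ∀ {i}, ¬ p i → q i = ⟨0, P.zero⟩ := fun h => if_neg h
  have hp : ∀ i, Fin (q i).1 → p i := fun i j => by
    by_contra h
    rw [q0 h] at j
    exact j.elim0
  have hsub : ∀ i, Subsingleton (Fin (q i).1) := fun i => by
    by_cases h : p i
    · rw [q1 h]; exact inferInstanceAs (Subsingleton (Fin 1))
    · rw [q0 h]; exact inferInstanceAs (Subsingleton (Fin 0))
  -- Each `q i` has one input if `p i` and none otherwise, so the inputs of the composite are the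
  -- indices satisfying `p`.
  let e : (Σ i, Fin (q i).1) ≃ {i // p i} :=
    { toFun := fun x => ⟨x.1, hp x.1 x.2⟩
      invFun := fun i => ⟨i.1, ⟨0, by rw [q1 i.2]; exact Nat.one_pos⟩⟩
      left_inv := fun x => Sigma.ext rfl (heq_of_eq ((hsub x.1).elim _ _))
      right_inv := fun _ => rfl }
  refine ⟨_, P.γ θ fun i => (q i).2, finSigmaFinEquiv.symm.trans e, fun A a => ?_⟩
  rw [A.op_γ]
  congr 1
  funext i
  by_cases h : p i
  · rw [dif_pos h]
    refine A.op_eq_of_one (q1 h) fun j => ?_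
    rw [Equiv.trans_apply, Equiv.symm_apply_apply]
    rfl
  · rw [dif_neg h]
    exact A.op_eq_unit (q0 h) _

/-- Both sides are multilinear in `x`, so the identity follows from its case of basis elements,
`exists_op_insert_unit`. -/
theorem exists_zOp_insert_unit {k : ℕ} (θ : P.Op k) (p : Fin k → Prop) [DecidablePred p] :
    ∃ (r : ℕ) (θ' : P.Op r) (e : Fin r ≃ {i // p i}),
      ∀ (A : OpAlg P) (x : {i // p i} → A.carrier →₀ ℤ),
        (A.zOp θ' fun t => x (e t)) =
          A.zOp θ fun i => if h : p i then x ⟨i, h⟩ else Finsupp.single A.unit 1 := by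
  obtain ⟨r, θ', e, he⟩ := exists_op_insert_unit θ p
  refine ⟨r, θ', e, fun A x => ?_⟩
  have h : (A.zOp θ').domDomCongr e =
      (A.zOp θ).domDomRestrict p fun _ => Finsupp.single A.unit 1 := by
    refine Module.Basis.ext_multilinear (fun _ => Finsupp.basisSingleOne (R := ℤ)) fun a => ?_
    have h2 : (fun i => if h : p i then Finsupp.single (a ⟨i, h⟩) (1 : ℤ)
        else Finsupp.single A.unit 1) =
        fun i => Finsupp.single (if h : p i then a ⟨i, h⟩ else A.unit) (1 : ℤ) := by
      funext i
      split_ifs <;> rfl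
    simp only [MultilinearMap.domDomCongr_apply, MultilinearMap.domDomRestrict_apply,
      Finsupp.coe_basisSingleOne, h2, zOp_single, he]
  exact DFunLike.congr_fun h x

theorem aug_single (A : OpAlg P) (a : A.carrier) (c : ℤ) : A.aug (Finsupp.single a c) = c := by
  simp [aug]

/-- On basis elements both sides are `1`. Consequently a single input of augmentation zero puts the
value of `θ̄` into the augmentation ideal. -/
theorem aug_zOp (A : OpAlg P) {k : ℕ} (θ : P.Op k) (x : Fin k → A.carrier →₀ ℤ) :
    A.aug (A.zOp θ x) = ∏ i, A.aug (x i) := by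
  have h : (A.aug.toIntLinearMap).compMultilinearMap (A.zOp θ) =
      (MultilinearMap.mkPiAlgebra ℤ (Fin k) ℤ).compLinearMap fun _ => A.aug.toIntLinearMap := by
    refine Module.Basis.ext_multilinear (fun _ => Finsupp.basisSingleOne (R := ℤ)) fun a => ?_
    simp [zOp_single, aug_single]
  exact DFunLike.congr_fun h x

/-- A trivial homomorphism sends `x` to `ε(x) · 1_B`. This is why killing a summand annihilates
every term with an input from its augmentation ideal. -/
theorem mapDomain_eq_zero {A B : OpAlg P} (f : A ⟶ B) (hf : ∀ a, f.toFun a = B.unit)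
    {x : A.carrier →₀ ℤ} (hx : x ∈ A.augIdeal) : Finsupp.mapDomain f.toFun x = 0 := by
  have h : ∀ x : A.carrier →₀ ℤ,
      Finsupp.mapDomain f.toFun x = Finsupp.single B.unit (A.aug x) := by
    intro x
    induction x using Finsupp.induction_linear with
    | zero => simp
    | add a b ha hb => rw [Finsupp.mapDomain_add, ha, hb, map_add, Finsupp.single_add]
    | single a c => rw [Finsupp.mapDomain_single, hf, aug_single]
  rw [h x, show A.aug x = 0 from hx, Finsupp.single_zero]

theorem closure_range_single (X : Type*) :
    AddSubgroup.closure (Set.range fun a : X => Finsupp.single a (1 : ℤ)) = ⊤ := by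
  rw [eq_top_iff]
  rintro x -
  induction x using Finsupp.induction_linear with
  | zero => exact zero_mem _
  | add a b ha hb => exact add_mem ha hb
  | single a c =>
    have h : Finsupp.single a c = c • Finsupp.single a (1 : ℤ) := by simp
    rw [h]
    exact zsmul_mem (AddSubgroup.subset_closure (Set.mem_range_self a)) c

end OpAlg

namespace OpAlg

variable {P : UnitaryOperad.{u}}

theorem augMk_unit (A : OpAlg P) : A.augMk A.unit = 0 :=
  Subtype.ext (sub_self _)

theorem augMap_augMk {A B : OpAlg P} (f : A ⟶ B) (a : A.carrier) :
    OpAlg.augMap f (A.augMk a) = B.augMk (f.toFun a) := by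
  refine Subtype.ext ?_
  change Finsupp.mapDomain f.toFun
    (Finsupp.single a 1 - Finsupp.single A.unit 1 : A.carrier →₀ ℤ) = _
  rw [sub_eq_add_neg, Finsupp.mapDomain_add, ← Finsupp.single_neg, Finsupp.mapDomain_single,
    Finsupp.mapDomain_single, OpAlg.map_unit, Finsupp.single_neg, ← sub_eq_add_neg]
  rfl

end OpAlg

/-! ### Group rings of sums, filtered by the summands that occur -/

namespace PolyFunctor

section

variable {C : Type v} [Category.{u} C] {P : UnitaryOperad.{u}}

theorem mapDomain_map_comp (H : C ⥤ OpAlg P) {W Y Z : C} (f : W ⟶ Y) (g : Y ⟶ Z)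
    (x : (H.obj W).carrier →₀ ℤ) :
    Finsupp.mapDomain (H.map g).toFun (Finsupp.mapDomain (H.map f).toFun x) =
      Finsupp.mapDomain (H.map (f ≫ g)).toFun x := by
  rw [H.map_comp]
  exact Finsupp.mapDomain_comp.symm

theorem mapDomain_map_id (H : C ⥤ OpAlg P) {Y : C} (x : (H.obj Y).carrier →₀ ℤ) :
    Finsupp.mapDomain (H.map (𝟙 Y)).toFun x = x := by
  rw [H.map_id]
  exact Finsupp.mapDomain_id

variable [HasFiniteCoproducts C] {H : C ⥤ OpAlg P}

theorem ι_fold {r : ℕ} (Y : C) (j : Fin r) :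
    Sigma.ι (fun _ : Fin r => Y) j ≫ fold r Y = 𝟙 Y := by
  simp [fold]

/-- The coproducts `Y ∨ … ∨ Y` are generated, as algebras, by the images of the summands. -/
def GeneratesSums (H : C ⥤ OpAlg P) : Prop :=
  ∀ (r : ℕ) (Y : C) (a : (H.obj (∐ fun _ : Fin r => Y)).carrier),
    ∃ (k : ℕ) (θ : P.Op k) (c : Fin k → Fin r) (g : Fin k → (H.obj Y).carrier),
      a = (H.obj _).op θ fun j => (H.map (Sigma.ι (fun _ : Fin r => Y) (c j))).toFun (g j)

/-- The subgroup of `ℤ[H(Y ∨ … ∨ Y)]` spanned by the values of operations on elements of the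
augmentation ideals of the summands, where each of the summands in `S` occurs. -/
noncomputable def multiSpan (H : C ⥤ OpAlg P) (r : ℕ) (Y : C) (S : Finset (Fin r)) :
    AddSubgroup ((H.obj (∐ fun _ : Fin r => Y)).carrier →₀ ℤ) :=
  AddSubgroup.closure {y | ∃ (k : ℕ) (θ : P.Op k) (c : Fin k → Fin r)
    (x : Fin k → (H.obj Y).carrier →₀ ℤ), (∀ i, x i ∈ (H.obj Y).augIdeal) ∧
      (∀ j ∈ S, ∃ i, c i = j) ∧ y = (H.obj _).zOp θ fun i =>
        Finsupp.mapDomain (H.map (Sigma.ι (fun _ : Fin r => Y) (c i))).toFun (x i)}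

/-- Write each input of a generating expression as `(g - 1) + 1` and expand. The units in a term are
absorbed into the operation by inserting `0_P`. -/
theorem multiSpan_empty (hH : GeneratesSums H) (r : ℕ) (Y : C) : multiSpan H r Y ∅ = ⊤ := by
  classical
  rw [eq_top_iff, ← OpAlg.closure_range_single, AddSubgroup.closure_le]
  rintro _ ⟨a, rfl⟩
  obtain ⟨k, θ, c, g, rfl⟩ := hH r Y a
  let B := H.obj (∐ fun _ : Fin r => Y)
  let x : Fin k → B.carrier →₀ ℤ := fun j =>
    Finsupp.mapDomain (H.map (Sigma.ι (fun _ : Fin r => Y) (c j))).toFun ((H.obj Y).augMk (g j))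
  have h : (fun j => Finsupp.single ((H.map (Sigma.ι (fun _ : Fin r => Y) (c j))).toFun (g j))
      (1 : ℤ)) = x + fun _ => Finsupp.single B.unit 1 := by
    funext j
    have := congrArg Subtype.val
      (OpAlg.augMap_augMk (H.map (Sigma.ι (fun _ : Fin r => Y) (c j))) (g j))
    refine Eq.trans ?_ (congrArg (· + Finsupp.single B.unit (1 : ℤ)) this.symm)
    exact (sub_add_cancel _ _).symm
  change Finsupp.single (B.op θ _) 1 ∈ _
  rw [← OpAlg.zOp_single, h, MultilinearMap.map_add_univ]
  -- In the term indexed by `s`, the inputs in `s` are of the form `g - 1` and all others are the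
  -- unit.
  refine sum_mem fun s _ => ?_
  obtain ⟨t, θ', e, he⟩ := OpAlg.exists_zOp_insert_unit θ (· ∈ s)
  refine AddSubgroup.subset_closure ⟨t, θ', fun i => c (e i),
    fun i => (H.obj Y).augMk (g (e i)), fun i => Subtype.prop _, by simp, ?_⟩
  refine Eq.trans ?_ (he B fun i => x i).symm
  congr 1

/-- Folding undoes the inclusions of the summands. If all `n + 1` summands occur, the assignment of
summands to inputs is surjective, so the arity is at least `n + 1`. -/
theorem map_fold_multiSpan (n : ℕ) (Y : C) {w : (H.obj (∐ fun _ : Fin (n + 1) => Y)).carrier →₀ ℤ}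
    (hw : w ∈ multiSpan H (n + 1) Y Finset.univ) :
    Finsupp.mapDomain (H.map (fold (n + 1) Y)).toFun w ∈ (H.obj Y).idealPow (n + 1) := by
  suffices multiSpan H (n + 1) Y Finset.univ ≤ ((H.obj Y).idealPow (n + 1)).comap
    (Finsupp.mapDomain.addMonoidHom (H.map (fold (n + 1) Y)).toFun) from this hw
  rw [multiSpan, AddSubgroup.closure_le]
  rintro _ ⟨m, θ, c, x, hx, hc, rfl⟩
  change Finsupp.mapDomain (M := ℤ) (H.map (fold (n + 1) Y)).toFun _ ∈ (H.obj Y).idealPow (n + 1)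
  rw [OpAlg.zOp_mapDomain]
  simp only [mapDomain_map_comp, ι_fold, mapDomain_map_id]
  refine AddSubgroup.subset_closure ⟨m, ?_, θ, x, hx, rfl⟩
  simpa using Fintype.card_le_of_surjective c fun j => hc j (Finset.mem_univ j)

end

/-! ### The Taylor kernel as a power of the augmentation ideal -/

variable {C : Type v} [Category.{u} C] [HasZeroMorphisms C] {P : UnitaryOperad.{u}}

/-- A natural algebra structure on the pointed sets `Hom(X, Y)`, up to a bijection. -/
structure AlgRepresentation (X : C) (H : C ⥤ OpAlg P) where
  equiv : ∀ Y, (X ⟶ Y) ≃ (H.obj Y).carrier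
  equiv_comp : ∀ {Y Z} (f : X ⟶ Y) (g : Y ⟶ Z), equiv Z (f ≫ g) = (H.map g).toFun (equiv Y f)
  equiv_zero : ∀ Y, equiv Y 0 = (H.obj Y).unit

namespace AlgRepresentation

variable {X : C} {H : C ⥤ OpAlg P} (E : AlgRepresentation X H)

noncomputable def toAugHom (Y : C) : (univFunctor X).obj Y →+ (H.obj Y).augIdeal :=
  QuotientAddGroup.lift _ (Finsupp.liftAddHom fun f : X ⟶ Y =>
      zmultiplesHom _ ((H.obj Y).augMk (E.equiv Y f))) <| by
    rw [AddSubgroup.zmultiples_le, AddMonoidHom.mem_ker, Finsupp.liftAddHom_apply_single,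
      zmultiplesHom_apply, one_zsmul, E.equiv_zero, OpAlg.augMk_unit]

theorem toAugHom_mk {Y : C} (f : X ⟶ Y) :
    E.toAugHom Y (univMk f) = (H.obj Y).augMk (E.equiv Y f) := by
  refine (Finsupp.liftAddHom_apply_single _ f (1 : ℤ)).trans ?_
  rw [zmultiplesHom_apply, one_zsmul]

/-- The linear extension to the whole group ring, restricted to the ideal. The distinguished element
goes to the class of the zero morphism, which vanishes, so `a - 1` and `a` have the same image. -/
noncomputable def ofAugHom (Y : C) : (H.obj Y).augIdeal →+ (univFunctor X).obj Y :=
  (Finsupp.liftAddHom fun a : (H.obj Y).carrier =>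
    zmultiplesHom _ (univMk ((E.equiv Y).symm a))).comp (H.obj Y).augIdeal.subtype

theorem ofAugHom_mk {Y : C} (a : (H.obj Y).carrier) :
    E.ofAugHom Y ((H.obj Y).augMk a) = univMk ((E.equiv Y).symm a) := by
  have h : (E.equiv Y).symm (H.obj Y).unit = 0 := by rw [Equiv.symm_apply_eq, E.equiv_zero]
  refine (map_sub (Finsupp.liftAddHom fun a : (H.obj Y).carrier =>
    zmultiplesHom _ (univMk ((E.equiv Y).symm a))) (Finsupp.single a 1)
      (Finsupp.single (H.obj Y).unit 1)).trans ?_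
  rw [Finsupp.liftAddHom_apply_single, Finsupp.liftAddHom_apply_single, zmultiplesHom_apply,
    zmultiplesHom_apply, one_zsmul, one_zsmul, h, univMk_zero, sub_zero]

/-- The isomorphism `U_X(Y) ≅ I(Hom(X, Y))`, `f ↦ f - 0`. -/
noncomputable def augEquiv (Y : C) : (univFunctor X).obj Y ≃+ (H.obj Y).augIdeal :=
  AddMonoidHom.toAddEquiv (E.toAugHom Y) (E.ofAugHom Y)
    (univ_hom_ext fun f => by
      rw [AddMonoidHom.comp_apply, toAugHom_mk, ofAugHom_mk, Equiv.symm_apply_apply]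
      rfl)
    (AddMonoidHom.eq_of_eqOn_dense (OpAlg.aug_span _) (by
      rintro _ ⟨a, rfl⟩
      rw [AddMonoidHom.comp_apply, ofAugHom_mk, toAugHom_mk, Equiv.apply_symm_apply]
      rfl))

theorem augEquiv_mk {Y : C} (f : X ⟶ Y) :
    E.augEquiv Y (univMk f) = (H.obj Y).augMk (E.equiv Y f) :=
  E.toAugHom_mk f

theorem augEquiv_map {Y Z : C} (g : Y ⟶ Z) (x : (univFunctor X).obj Y) :
    E.augEquiv Z (((univFunctor X).map g).hom x) =
      OpAlg.augMap (H.map g) (E.augEquiv Y x) := by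
  have h : (E.augEquiv Z).toAddMonoidHom.comp ((univFunctor X).map g).hom =
      (OpAlg.augMap (H.map g)).comp (E.augEquiv Y).toAddMonoidHom := univ_hom_ext fun f => by
    change E.augEquiv Z (((univFunctor X).map g).hom (univMk f)) =
      OpAlg.augMap (H.map g) (E.augEquiv Y (univMk f))
    rw [univ_map_mk, augEquiv_mk, augEquiv_mk, OpAlg.augMap_augMk, E.equiv_comp]
  exact DFunLike.congr_fun h x

theorem coe_augEquiv_map {Y Z : C} (g : Y ⟶ Z) (x : (univFunctor X).obj Y) :
    (E.augEquiv Z (((univFunctor X).map g).hom x) : (H.obj Z).carrier →₀ ℤ) =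
      Finsupp.mapDomain (H.map g).toFun (E.augEquiv Y x : (H.obj Y).carrier →₀ ℤ) :=
  congrArg Subtype.val (E.augEquiv_map g x)

include E in
theorem map_zero_toFun {Y Z : C} (a : (H.obj Y).carrier) :
    (H.map (0 : Y ⟶ Z)).toFun a = (H.obj Z).unit := by
  obtain ⟨f, rfl⟩ := (E.equiv Y).surjective a
  rw [← E.equiv_comp, comp_zero, E.equiv_zero]

include E in
theorem mapDomain_map_zero {Y Z : C} {x : (H.obj Y).carrier →₀ ℤ} (hx : x ∈ (H.obj Y).augIdeal) :
    Finsupp.mapDomain (H.map (0 : Y ⟶ Z)).toFun x = 0 :=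
  OpAlg.mapDomain_eq_zero _ E.map_zero_toFun hx

section

variable [HasFiniteCoproducts C]

theorem ι_retract {r : ℕ} (Y : C) (k j : Fin r) :
    Sigma.ι (fun _ : Fin r => Y) j ≫ retract (fun _ : Fin r => Y) k =
      if h : j = k then 0 else Sigma.ι (fun _ : {j : Fin r // j ≠ k} => Y) ⟨j, h⟩ := by
  simp [retract]

/-- Spreading the inputs of `θ̄` over all `n + 1` copies of `Y` lifts the value to a cross-effect
element. No generation hypothesis is needed for this direction. -/
theorem idealPow_le (n : ℕ) (Y : C) : (H.obj Y).idealPow (n + 1) ≤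
    ((taylorKer n (univFunctor X) Y).map (E.augEquiv Y).toAddMonoidHom).map
      (H.obj Y).augIdeal.subtype := by
  rw [OpAlg.idealPow, AddSubgroup.closure_le]
  rintro _ ⟨k, hk, θ, x, hx, rfl⟩
  -- Input `i` goes to summand `i mod (n + 1)`; since `k ≥ n + 1`, every summand is used.
  let c : Fin k → Fin (n + 1) := fun i => Fin.ofNat (n + 1) i
  have hc : ∀ j, ∃ i, c i = j := fun j =>
    ⟨⟨j, by omega⟩, Fin.ext (Nat.mod_eq_of_lt j.2)⟩
  let Z := ∐ fun _ : Fin (n + 1) => Y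
  let y : Fin k → (H.obj Z).carrier →₀ ℤ := fun i =>
    Finsupp.mapDomain (H.map (Sigma.ι (fun _ : Fin (n + 1) => Y) (c i))).toFun (x i)
  have hz : (H.obj Z).zOp θ y ∈ (H.obj Z).augIdeal := by
    rw [OpAlg.augIdeal, AddMonoidHom.mem_ker, OpAlg.aug_zOp]
    -- One factor of augmentation zero suffices; input `0` exists because `k ≥ n + 1 > 0`.
    refine Finset.prod_eq_zero (Finset.mem_univ (⟨0, by omega⟩ : Fin k)) ?_
    exact (OpAlg.aug_mapDomain _ _).trans (hx _)
  let z : (univFunctor X).obj Z := (E.augEquiv Z).symm ⟨_, hz⟩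
  have hz' : (E.augEquiv Z z : (H.obj Z).carrier →₀ ℤ) = (H.obj Z).zOp θ y :=
    congrArg Subtype.val ((E.augEquiv Z).apply_symm_apply ⟨_, hz⟩)
  refine ⟨E.augEquiv Y (((univFunctor X).map (fold (n + 1) Y)).hom z),
    ⟨_, ⟨z, ?_, rfl⟩, rfl⟩, ?_⟩
  · simp only [crossEffect, SetLike.mem_coe, AddSubgroup.mem_iInf, AddMonoidHom.mem_ker]
    intro j
    refine (E.augEquiv _).injective (Subtype.ext ?_)
    rw [coe_augEquiv_map, hz', OpAlg.zOp_mapDomain, map_zero]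
    -- Some input lies in summand `j`. The retraction sends it to zero, and multilinearity does the
    -- rest.
    obtain ⟨i, hi⟩ := hc j
    refine MultilinearMap.map_coord_zero _ i ?_
    rw [mapDomain_map_comp, ι_retract, dif_pos hi]
    exact E.mapDomain_map_zero (hx i)
  · change (E.augEquiv Y _ : (H.obj Y).carrier →₀ ℤ) = _
    rw [coe_augEquiv_map, hz', OpAlg.zOp_mapDomain]
    congr 1
    funext i
    rw [mapDomain_map_comp, ι_fold, mapDomain_map_id]

-- The endomorphism `q` annihilates a spanning element in which summand `k` occurs and fixes one in
-- which it does not. Hence `1 - q` keeps the former, which already belongs to the smaller span, and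
-- kills the latter.
include E in
theorem sub_mem_multiSpan_insert (r : ℕ) (Y : C) (S : Finset (Fin r)) (k : Fin r)
    (q : (∐ fun _ : Fin r => Y) ⟶ ∐ fun _ : Fin r => Y)
    (hq : ∀ j, Sigma.ι (fun _ : Fin r => Y) j ≫ q =
      if j = k then 0 else Sigma.ι (fun _ : Fin r => Y) j)
    {w : (H.obj (∐ fun _ : Fin r => Y)).carrier →₀ ℤ} (hw : w ∈ multiSpan H r Y S) :
    w - Finsupp.mapDomain (H.map q).toFun w ∈ multiSpan H r Y (insert k S) := by
  let D : ((H.obj (∐ fun _ : Fin r => Y)).carrier →₀ ℤ) →+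
      (H.obj (∐ fun _ : Fin r => Y)).carrier →₀ ℤ :=
    AddMonoidHom.id _ - Finsupp.mapDomain.addMonoidHom (H.map q).toFun
  suffices multiSpan H r Y S ≤ (multiSpan H r Y (insert k S)).comap D from this hw
  rw [multiSpan, AddSubgroup.closure_le]
  rintro _ ⟨m, θ, c, x, hx, hc, rfl⟩
  change _ - Finsupp.mapDomain (M := ℤ) (H.map q).toFun _ ∈ multiSpan H r Y (insert k S)
  rw [OpAlg.zOp_mapDomain]
  simp only [mapDomain_map_comp, hq]
  by_cases h : ∃ i, c i = k
  · have h0 : ((H.obj (∐ fun _ : Fin r => Y)).zOp θ fun i => Finsupp.mapDomain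
        (H.map (if c i = k then 0 else Sigma.ι (fun _ : Fin r => Y) (c i))).toFun (x i)) = 0 := by
      obtain ⟨i, hi⟩ := h
      refine MultilinearMap.map_coord_zero _ i ?_
      rw [if_pos hi]
      exact E.mapDomain_map_zero (hx i)
    rw [h0, sub_zero]
    refine AddSubgroup.subset_closure ⟨m, θ, c, x, hx, fun j hj => ?_, rfl⟩
    rcases Finset.mem_insert.1 hj with rfl | hj
    · exact h
    · exact hc j hj
  · push Not at h
    simp only [h, if_false, AddMonoidHom.id_apply, sub_self]
    exact zero_mem _

/-- A cross-effect element is unchanged by each `1 - q_k`, where `q_k` kills summand `k`. Applying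
these one after another forces all summands to occur. -/
theorem augEquiv_mem_idealPow (hH : GeneratesSums H) (n : ℕ) {Y : C} {x : (univFunctor X).obj Y}
    (hx : x ∈ taylorKer n (univFunctor X) Y) :
    (E.augEquiv Y x : (H.obj Y).carrier →₀ ℤ) ∈ (H.obj Y).idealPow (n + 1) := by
  obtain ⟨z, hz, rfl⟩ := hx
  simp only [crossEffect, SetLike.mem_coe, AddSubgroup.mem_iInf, AddMonoidHom.mem_ker] at hz
  let w := (E.augEquiv _ z : (H.obj (∐ fun _ : Fin (n + 1) => Y)).carrier →₀ ℤ)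
  rw [coe_augEquiv_map]
  have hw : ∀ S, w ∈ multiSpan H (n + 1) Y S := by
    intro S
    induction S using Finset.induction with
    | empty => rw [multiSpan_empty hH]; trivial
    | insert k S _ ih =>
      -- The inclusion of the sum without summand `k`; it turns the retraction into the endomorphism
      -- `q_k`. As `q_k` factors through the retraction, it sends `w` to zero.
      let s : (∐ fun _ : {j : Fin (n + 1) // j ≠ k} => Y) ⟶ ∐ fun _ : Fin (n + 1) => Y :=
        Sigma.desc fun j => Sigma.ι (fun _ : Fin (n + 1) => Y) j.1
      have h0 : Finsupp.mapDomain (H.map (retract (fun _ : Fin (n + 1) => Y) k ≫ s)).toFun w =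
          0 := by
        rw [← mapDomain_map_comp, ← coe_augEquiv_map, hz k, map_zero]
        exact Finsupp.mapDomain_zero
      have h1 := E.sub_mem_multiSpan_insert (n + 1) Y S k (retract (fun _ : Fin (n + 1) => Y) k ≫ s)
        (fun j => by
          rw [← Category.assoc, ι_retract]
          split_ifs with h
          · rw [zero_comp]
          · simp [s]) ih
      rwa [h0, sub_zero] at h1
  exact map_fold_multiSpan n Y (hw _)

theorem map_taylorKer (hH : GeneratesSums H) (n : ℕ) (Y : C) :
    (taylorKer n (univFunctor X) Y).map (E.augEquiv Y).toAddMonoidHom =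
      ((H.obj Y).idealPow (n + 1)).addSubgroupOf (H.obj Y).augIdeal := by
  refine le_antisymm ?_ fun x hx => ?_
  · rintro _ ⟨x, hx, rfl⟩
    exact E.augEquiv_mem_idealPow hH n hx
  · obtain ⟨y, hy, e⟩ := E.idealPow_le n Y hx
    have : y = x := Subtype.ext e
    exact this ▸ hy

/-- The isomorphism `T_n U_X(Y) ≅ P_n(Hom(X, Y))`, `t_n(f) ↦ p_n(f)`. -/
noncomputable def taylorEquiv (hH : GeneratesSums H) (n : ℕ) (Y : C) :
    ((taylor n).obj (univFunctor X)).obj Y ≃+ (OpAlg.passi P n).obj (H.obj Y) :=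
  QuotientAddGroup.congr _ _ (E.augEquiv Y) (E.map_taylorKer hH n Y)

theorem taylorEquiv_class (hH : GeneratesSums H) (n : ℕ) {Y : C} (f : X ⟶ Y) :
    E.taylorEquiv hH n Y (taylorClass n f) = OpAlg.passiMk n (H.obj Y) (E.equiv Y f) :=
  congrArg (OpAlg.passiQuot n (H.obj Y)) (E.augEquiv_mk f)

noncomputable def taylorIso (hH : GeneratesSums H) (n : ℕ) :
    (taylor n).obj (univFunctor X) ≅ H ⋙ OpAlg.passi P n :=
  NatIso.ofComponents (fun Y => (E.taylorEquiv hH n Y).toAddCommGrpIso) fun {Y Z} g => by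
    ext x
    obtain ⟨x, rfl⟩ := QuotientAddGroup.mk_surjective x
    exact congrArg (OpAlg.passiQuot n (H.obj Z)) (E.augEquiv_map g x)

theorem taylorIso_class (hH : GeneratesSums H) (n : ℕ) {Y : C} (f : X ⟶ Y) :
    ((E.taylorIso hH n).hom.app Y).hom (taylorClass n f) =
      OpAlg.passiMk n (H.obj Y) (E.equiv Y f) :=
  E.taylorEquiv_class hH n f

end

end AlgRepresentation

end PolyFunctor

/-! ### Subalgebras generated by a set -/

namespace OpAlg

variable {P : UnitaryOperad.{u}}

/-- The subalgebra generated by a set. -/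
def opSpan {B : OpAlg P} (G : Set B.carrier) : Set B.carrier :=
  {a | ∃ (k : ℕ) (θ : P.Op k) (g : Fin k → B.carrier), (∀ j, g j ∈ G) ∧ a = B.op θ g}

theorem subset_opSpan {B : OpAlg P} (G : Set B.carrier) : G ⊆ opSpan G :=
  fun a ha => ⟨1, P.one, fun _ => a, fun _ => ha, (B.op_one fun _ => a).symm⟩

/-- The composition `γ` merges nested operations into one, so values of single operations on `G`
already form a subalgebra. -/
theorem op_mem_opSpan {B : OpAlg P} {G : Set B.carrier} {k : ℕ} (θ : P.Op k)
    {x : Fin k → B.carrier} (hx : ∀ i, x i ∈ opSpan G) : B.op θ x ∈ opSpan G := by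
  choose m φ g hg h using hx
  refine ⟨_, P.γ θ φ, fun t => g (finSigmaFinEquiv.symm t).1 (finSigmaFinEquiv.symm t).2,
    fun t => hg _ _, ?_⟩
  rw [B.op_γ]
  refine congrArg (B.op θ) (funext fun i => (h i).trans (congrArg _ (funext fun j => ?_)))
  exact congrArg (fun p : Σ i, Fin (m i) => g p.1 p.2)
    (finSigmaFinEquiv.symm_apply_apply ⟨i, j⟩).symm

theorem unit_mem_opSpan {B : OpAlg P} (G : Set B.carrier) : B.unit ∈ opSpan G :=
  op_mem_opSpan P.zero fun i => i.elim0

/-- A subset closed under the operations is an algebra. -/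
def sub (B : OpAlg P) (S : Set B.carrier)
    (hS : ∀ {k : ℕ} (θ : P.Op k) (x : Fin k → B.carrier), (∀ i, x i ∈ S) → B.op θ x ∈ S) :
    OpAlg P where
  carrier := S
  op θ x := ⟨B.op θ fun i => x i, hS θ _ fun i => (x i).2⟩
  op_act θ σ _ := Subtype.ext (B.op_act θ σ _)
  op_one _ := Subtype.ext (B.op_one _)
  op_γ θ φ _ := Subtype.ext (B.op_γ θ φ _)

def subIncl (B : OpAlg P) (S : Set B.carrier)
    (hS : ∀ {k : ℕ} (θ : P.Op k) (x : Fin k → B.carrier), (∀ i, x i ∈ S) → B.op θ x ∈ S) :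
    B.sub S hS ⟶ B where
  toFun a := a.1
  map_op _ _ := rfl

def subLift {A B : OpAlg P} (f : A ⟶ B) (S : Set B.carrier)
    (hS : ∀ {k : ℕ} (θ : P.Op k) (x : Fin k → B.carrier), (∀ i, x i ∈ S) → B.op θ x ∈ S)
    (hf : ∀ a, f.toFun a ∈ S) : A ⟶ B.sub S hS where
  toFun a := ⟨f.toFun a, hf a⟩
  map_op θ x := Subtype.ext (f.map_op θ x)

/-- The images of a family of homomorphisms. -/
def images {A B : OpAlg P} {r : ℕ} (f : Fin r → (A ⟶ B)) : Set B.carrier :=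
  {b | ∃ j a, (f j).toFun a = b}

theorem exists_eq_of_mem_opSpan_images {A B : OpAlg P} {r : ℕ} {f : Fin r → (A ⟶ B)}
    {b : B.carrier} (hb : b ∈ opSpan (images f)) :
    ∃ (k : ℕ) (θ : P.Op k) (c : Fin k → Fin r) (g : Fin k → A.carrier),
      b = B.op θ fun j => (f (c j)).toFun (g j) := by
  obtain ⟨k, θ, x, hx, rfl⟩ := hb
  choose c g h using hx
  exact ⟨k, θ, c, g, by simp only [h]⟩

/-- Induction on a term representing the element. -/
theorem free_eq_opSpan (X : Type u) (a : (free P X).carrier) :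
    a ∈ opSpan (Set.range (freeEquiv X (free P X) (𝟙 _))) := by
  induction a using Quotient.inductionOn with
  | h t =>
    induction t with
    | of x => exact subset_opSpan _ ⟨x, rfl⟩
    | op θ t ih =>
      have h := presented.mk_op (P := P) (fun _ _ : Term P X => False) θ t
      exact Set.mem_of_eq_of_mem h (op_mem_opSpan θ ih)

theorem freeFin_eq_opSpan (m : ℕ) (a : (freeFin P m).carrier) :
    a ∈ opSpan (Set.range (ev m (freeFin P m) (𝟙 _))) := by
  obtain ⟨k, θ, g, hg, rfl⟩ := free_eq_opSpan _ a
  refine ⟨k, θ, g, fun j => ?_, rfl⟩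
  obtain ⟨x, hx⟩ := hg j
  exact ⟨x.down, hx⟩

end OpAlg

/-! ### Sums are generated by their summands -/

namespace PolyFunctor

open OpAlg

section

variable {C : Type v} [Category.{u} C] {P : UnitaryOperad.{u}} [HasFiniteCoproducts C]

theorem generatesSums_of_opSpan {H : C ⥤ OpAlg P}
    (h : ∀ (r : ℕ) (Y : C) (a : (H.obj (∐ fun _ : Fin r => Y)).carrier),
      a ∈ opSpan (images fun j => H.map (Sigma.ι (fun _ : Fin r => Y) j))) : GeneratesSums H :=
  fun r Y a => exists_eq_of_mem_opSpan_images (h r Y a)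

/-- If an operation has a unit, generation by the summands passes to finite powers. -/
theorem GeneratesSums.pow {H V : C ⥤ OpAlg P} (hV : GeneratesSums V) {θ : P.Op 2}
    (hθ : P.IsUnital θ) {m : ℕ} (pr : Fin m → (H ⟶ V))
    (hpr : ∀ Y, Function.Bijective fun (a : (H.obj Y).carrier) i => ((pr i).app Y).toFun a) :
    GeneratesSums H := by
  classical
  refine generatesSums_of_opSpan fun r Y a => ?_
  let Z := ∐ fun _ : Fin r => Y
  let E : ∀ Y, (H.obj Y).carrier ≃ (Fin m → (V.obj Y).carrier) := fun Y =>
    Equiv.ofBijective _ (hpr Y)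
  have E_op : ∀ {Y k} (φ : P.Op k) (x : Fin k → (H.obj Y).carrier) i,
      E Y ((H.obj Y).op φ x) i = (V.obj Y).op φ fun j => E Y (x j) i :=
    fun φ x i => ((pr i).app _).map_op φ x
  have E_map : ∀ {Y Z} (g : Y ⟶ Z) (x : (H.obj Y).carrier) i,
      E Z ((H.map g).toFun x) i = (V.map g).toFun (E Y x i) := fun g x i =>
    congrArg (fun q => Hom.toFun q x) ((pr i).naturality g)
  have E_unit : ∀ Y i, E Y (H.obj Y).unit i = (V.obj Y).unit := fun Y i =>
    map_unit ((pr i).app Y)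
  -- The tuple with `b` in position `i` and the distinguished element in all other positions.
  let δ : ∀ Y, Fin m → (V.obj Y).carrier → (H.obj Y).carrier := fun Y i b =>
    (E Y).symm fun j => if j = i then b else (V.obj Y).unit
  have Eδ : ∀ {Y} i (b : (V.obj Y).carrier) j,
      E Y (δ Y i b) j = if j = i then b else (V.obj Y).unit := fun i b j =>
    congrFun ((E _).apply_symm_apply _) j
  have hδ : ∀ i (b : (V.obj Z).carrier),
      δ Z i b ∈ opSpan (images fun j => H.map (Sigma.ι (fun _ : Fin r => Y) j)) := by
    intro i b
    -- The operation that expresses `b` through the summands also expresses the tuple: in the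
    -- remaining coordinates it is applied to units only and returns the unit.
    obtain ⟨k, φ, c, g, rfl⟩ := hV r Y b
    refine ⟨k, φ, fun j => (H.map (Sigma.ι (fun _ : Fin r => Y) (c j))).toFun (δ Y i (g j)),
      fun j => ⟨_, _, rfl⟩, (E Z).injective (funext fun j => ?_)⟩
    rw [Eδ, E_op]
    simp only [E_map, Eδ]
    split_ifs
    · rfl
    · simp only [map_unit]
      exact (op_unit _ φ).symm
  -- Restore the coordinates of `a` one at a time. Multiplying the truncated tuple by `δ_i(a_i)`
  -- with `θ` gives `θ(1, a_i) = a_i` in coordinate `i` and `θ(b, 1) = b` elsewhere.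
  have key : ∀ s : Finset (Fin m),
      (E Z).symm (fun j => if j ∈ s then E Z a j else (V.obj Z).unit) ∈
        opSpan (images fun j => H.map (Sigma.ι (fun _ : Fin r => Y) j)) := by
    intro s
    induction s using Finset.induction with
    | empty =>
      refine Set.mem_of_eq_of_mem ?_ (unit_mem_opSpan _)
      rw [Equiv.symm_apply_eq]
      funext j
      exact (E_unit Z j).symm
    | insert i s hi ih =>
      refine Set.mem_of_eq_of_mem ?_ (op_mem_opSpan θ
        (x := ![_, _]) (Fin.forall_fin_two.2 ⟨ih, hδ i (E Z a i)⟩))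
      rw [Equiv.symm_apply_eq]
      funext j
      have e : ∀ x y : (H.obj Z).carrier,
          (fun k => E Z ((![x, y] : Fin 2 → (H.obj Z).carrier) k) j) = ![E Z x j, E Z y j] :=
        fun x y => funext fun k => by fin_cases k <;> rfl
      rw [E_op, e, Eδ, Equiv.apply_symm_apply]
      by_cases hj : j = i
      · subst hj
        rw [if_neg hi, if_pos rfl, if_pos (Finset.mem_insert_self _ _), op_unital_right _ hθ]
      · rw [if_neg hj, op_unital_left _ hθ]
        simp [Finset.mem_insert, hj]
  simpa using key Finset.univ

end

/-- In the full subcategory on free objects, finite sums are generated by the summands. -/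
theorem generatesSums_induced {P : UnitaryOperad.{u}} {D : Type v} [Category.{u} D] (F : ℕ → D)
    [HasFiniteCoproducts (InducedCategory D F)] (V : D ⥤ OpAlg P)
    (E : ∀ m A, (F m ⟶ A) ≃ (Fin m → (V.obj A).carrier))
    (hE : ∀ {m : ℕ} {A B : D} (f : F m ⟶ A) (g : A ⟶ B) (i : Fin m),
      E m B (f ≫ g) i = (V.map g).toFun (E m A f i))
    (hF : ∀ m a, a ∈ opSpan (Set.range (E m (F m) (𝟙 _)))) :
    GeneratesSums (inducedFunctor F ⋙ V) := by
  refine generatesSums_of_opSpan fun r Y a => ?_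
  have hE1 : ∀ {m : ℕ} {A : D} (f : F m ⟶ A) (i : Fin m),
      (V.map f).toFun (E m _ (𝟙 (F m)) i) = E m A f i :=
    fun f i => by rw [← hE, Category.id_comp]
  -- The chosen coproduct `Z` is known only by its universal property, so it is compared with the
  -- free object on `r · Y` generators, grouped in `r` blocks.
  let N : InducedCategory D F := (∑ _ : Fin r, (Y : ℕ) : ℕ)
  let inj : Fin r → (Y ⟶ N) := fun i => InducedCategory.homMk
    ((E _ _).symm fun j => E _ _ (𝟙 (F N)) (finSigmaFinEquiv (n := fun _ : Fin r => Y) ⟨i, j⟩))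
  let Z : InducedCategory D F := ∐ fun _ : Fin r => Y
  let ι : Fin r → (Y ⟶ Z) := Sigma.ι fun _ : Fin r => Y
  let s : N ⟶ Z := InducedCategory.homMk ((E _ _).symm fun t =>
    E _ _ (ι (finSigmaFinEquiv.symm t).1).hom (finSigmaFinEquiv.symm t).2)
  have hs : ∀ t, E _ _ s.hom t =
      E _ _ (ι (finSigmaFinEquiv.symm t).1).hom (finSigmaFinEquiv.symm t).2 :=
    fun t => congrFun ((E _ _).apply_symm_apply _) t
  let d : Z ⟶ N := Sigma.desc inj
  -- It suffices that `Z` is a retract of `N`: an element `a` is the image under `s` of `d(a)`, and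
  -- `s` carries each generator of `N` into the image of a summand.
  have hd : d ≫ s = 𝟙 Z := by
    refine Sigma.hom_ext _ _ fun i => ?_
    rw [← Category.assoc, Sigma.ι_desc, Category.comp_id]
    refine InducedCategory.hom_ext ((E _ _).injective (funext fun j => ?_))
    refine (hE (inj i).hom s.hom j).trans ?_
    have h : E _ _ (inj i).hom j =
        E _ _ (𝟙 (F N)) (finSigmaFinEquiv (n := fun _ : Fin r => Y) ⟨i, j⟩) :=
      congrFun ((E _ _).apply_symm_apply _) j
    rw [h, hE1, hs, Equiv.symm_apply_apply]
  have ha : (V.map s.hom).toFun ((V.map d.hom).toFun a) = a := by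
    have := congrArg (fun q => Hom.toFun q a)
      (((inducedFunctor F ⋙ V).map_comp d s).symm.trans
        ((congrArg (inducedFunctor F ⋙ V).map hd).trans ((inducedFunctor F ⋙ V).map_id Z)))
    exact this
  obtain ⟨k, θ, g, hg, e⟩ := hF N ((V.map d.hom).toFun a)
  rw [← ha, e, (V.map s.hom).map_op]
  refine ⟨k, θ, _, fun j => ?_, rfl⟩
  obtain ⟨t, ht⟩ := hg j
  refine ⟨(finSigmaFinEquiv.symm t).1, E _ _ (𝟙 (F Y)) (finSigmaFinEquiv.symm t).2, ?_⟩
  rw [← ht, hE1, hs]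
  exact hE1 (ι _).hom _

/-- The summands map into the subalgebra generated by their images, so the universal property gives
a section of its inclusion, and the subalgebra is everything. -/
theorem generatesSums_opAlg (P : UnitaryOperad.{u}) : GeneratesSums (𝟭 (OpAlg P)) := by
  refine generatesSums_of_opSpan fun r Y a => ?_
  let ι : Fin r → (Y ⟶ ∐ fun _ : Fin r => Y) := Sigma.ι fun _ : Fin r => Y
  let S := opSpan (images ι)
  have hS : ∀ {k : ℕ} (θ : P.Op k) (x : Fin k → (∐ fun _ : Fin r => Y).carrier),
    (∀ i, x i ∈ S) → (∐ fun _ : Fin r => Y).op θ x ∈ S := fun θ x hx => op_mem_opSpan θ hx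
  let d : (∐ fun _ : Fin r => Y) ⟶ (∐ fun _ : Fin r => Y).sub S hS :=
    Sigma.desc fun j => subLift (ι j) S hS fun y => subset_opSpan _ ⟨j, y, rfl⟩
  have hd : d ≫ subIncl _ S hS = 𝟙 _ := by
    refine Sigma.hom_ext _ _ fun i => ?_
    rw [← Category.assoc, Sigma.ι_desc, Category.comp_id]
    rfl
  have ha : (d.toFun a).1 = a := congrArg (fun q => Hom.toFun q a) hd
  rw [← ha]
  exact (d.toFun a).2

/-- The argument for algebras applies once the generated subalgebra is made into a model. -/
theorem generatesSums_model (T : PointedTheory.{u}) :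
    GeneratesSums (PointedTheory.forget T) := by
  refine generatesSums_of_opSpan fun r Y a => ?_
  let Z := ∐ fun _ : Fin r => Y
  let V := PointedTheory.forget T
  let ι : Fin r → (Y ⟶ Z) := Sigma.ι fun _ : Fin r => Y
  let S := opSpan (images fun j => V.map (ι j))
  have hS : ∀ {k : ℕ} (θ : T.operad.Op k) (x : Fin k → (V.obj Z).carrier),
    (∀ i, x i ∈ S) → (V.obj Z).op θ x ∈ S := fun θ x hx => op_mem_opSpan θ hx
  let B := (V.obj Z).sub S hS
  -- Compatibility with composition and projections consists of identities between operations, which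
  -- pass to subalgebras.
  have hB : PointedTheory.IsModel B :=
    ⟨fun f θ x => Subtype.ext ((PointedTheory.forget_isModel Z).op_comp f θ _),
      fun i x => Subtype.ext ((PointedTheory.forget_isModel Z).op_proj i _)⟩
  let lift : ∀ j, V.obj Y ⟶ B := fun j =>
    subLift (V.map (ι j)) S hS fun y => subset_opSpan _ ⟨j, y, rfl⟩
  let d : Z ⟶ PointedTheory.ofAlg B hB :=
    Sigma.desc fun j => PointedTheory.homOfAlg (lift j ≫ PointedTheory.ofAlgHom B hB)
  let i : PointedTheory.ofAlg B hB ⟶ Z :=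
    PointedTheory.homOfAlg (PointedTheory.ofAlgInv B hB ≫ subIncl _ S hS)
  have hd : d ≫ i = 𝟙 _ := by
    refine Sigma.hom_ext _ _ fun j => ?_
    rw [← Category.assoc, Sigma.ι_desc, Category.comp_id]
    refine PointedTheory.forget_injective ?_
    rw [Functor.map_comp, PointedTheory.forget_map_homOfAlg, PointedTheory.forget_map_homOfAlg]
    rfl
  have ha : (V.map i).toFun ((V.map d).toFun a) = a := by
    have := congrArg (fun q => Hom.toFun q a)
      ((V.map_comp d i).symm.trans ((congrArg V.map hd).trans (V.map_id Z)))
    exact this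
  -- On underlying algebras `i` factors through the inclusion of `S`, so its values lie in `S`.
  rw [← ha, PointedTheory.forget_map_homOfAlg]
  exact ((PointedTheory.ofAlgInv B hB).toFun ((V.map d).toFun a)).2

end PolyFunctor

/-! ### Transport of preadditive structures -/

namespace HomGroups

variable {C : Type v} [Category.{u} C] {H K : HomGroups C}

/-- Transport of a composition along isomorphisms of the morphism groups. -/
noncomputable def Composition.transport (S : H.Composition) (φ : ∀ X Y, H.N X Y ≃+ K.N X Y)
    (hφ : ∀ {X Y : C} (f : X ⟶ Y), φ X Y (H.p f) = K.p f) : K.Composition where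
  comp {X Y Z} := AddMonoidHom.mk' (fun a => (φ X Z).toAddMonoidHom.comp
      ((S.comp ((φ X Y).symm a)).comp (φ Y Z).symm.toAddMonoidHom)) fun a b => by
    ext c
    simp
  comp_p {X Y Z} f g := by
    change φ X Z (S.comp ((φ X Y).symm (K.p f)) ((φ Y Z).symm (K.p g))) = _
    rw [← hφ f, ← hφ g, AddEquiv.symm_apply_apply, AddEquiv.symm_apply_apply, S.comp_p, hφ]

/-- Isomorphic morphism groups give isomorphic preadditive categories. -/
theorem Composition.exists_isoCat (S : H.Composition) (φ : ∀ X Y, H.N X Y ≃+ K.N X Y)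
    (hφ : ∀ {X Y : C} (f : X ⟶ Y), φ X Y (H.p f) = K.p f) :
    ∃ (S' : K.Composition) (e : IsoCat S.Cat S'.Cat),
      e.functor.Additive ∧ S.functor ⋙ e.functor = S'.functor := by
  let S' := S.transport φ hφ
  -- The transported composition is the one for which `φ` is multiplicative, which is functoriality
  -- of `φ`.
  have hcomp : ∀ {X Y Z : C} (a : H.N X Y) (b : H.N Y Z),
      S'.comp (φ X Y a) (φ Y Z b) = φ X Z (S.comp a b) := fun {X Y Z} a b => by
    change φ X Z (S.comp ((φ X Y).symm (φ X Y a)) ((φ Y Z).symm (φ Y Z b))) = _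
    rw [AddEquiv.symm_apply_apply, AddEquiv.symm_apply_apply]
  let F : S.Cat ⥤ S'.Cat :=
    { obj := fun X => ⟨X.as⟩
      map := fun {X Y} f => φ X.as Y.as f
      map_id := fun X => hφ (𝟙 X.as)
      map_comp := fun f g => (hcomp f g).symm }
  let G : S'.Cat ⥤ S.Cat :=
    { obj := fun X => ⟨X.as⟩
      map := fun {X Y} f => (φ X.as Y.as).symm f
      map_id := fun X => (AddEquiv.symm_apply_eq _).2 (hφ (𝟙 X.as)).symm
      map_comp := fun {X Y Z} f g => (φ X.as Z.as).symm_apply_apply _ }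
  refine ⟨S', ⟨F, G, ?_, ?_⟩, ⟨?_⟩, ?_⟩
  · refine CategoryTheory.Functor.ext (fun _ => rfl) fun X Y f => ?_
    simp only [eqToHom_refl, Category.comp_id, Category.id_comp]
    exact ((φ X.as Y.as).symm_apply_apply f).symm
  · refine CategoryTheory.Functor.ext (fun _ => rfl) fun X Y f => ?_
    simp only [eqToHom_refl, Category.comp_id, Category.id_comp]
    exact (φ X.as Y.as).apply_symm_apply f
  · intro X Y f g
    exact map_add (φ X.as Y.as) f g
  · refine CategoryTheory.Functor.ext (fun _ => rfl) fun X Y f => ?_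
    exact (hφ f).trans ((Category.id_comp (S'.functor.map f ≫ 𝟙 _)).trans
      (Category.comp_id (S'.functor.map f))).symm

end HomGroups

/-! ### Representations and generation for algebras over an operad -/

namespace OpAlg

open PolyFunctor

variable {P : UnitaryOperad.{u}}

/-- Both homomorphisms take every generator to `1_A`. Thus the relation `[0] = 0` in the universal
functor matches the base point of the augmentation ideal. -/
theorem zero_eq_homAlg_unit (m : ℕ) (A : OpAlg P) :
    (0 : freeFin P m ⟶ A) = (homAlg m A).unit := by
  refine (ev m A).injective (funext fun i => ?_)
  refine Eq.trans ?_ (congrFun ((ev m A).apply_symm_apply _) i).symm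
  exact congrArg (A.op P.zero) (Subsingleton.elim _ _)

/-- The evaluation at a generator, as a homomorphism `Hom(F_P(m), A) → A`. -/
noncomputable def evAt (P : UnitaryOperad.{u}) {m : ℕ} (i : Fin m) :
    homFunctor P m ⟶ 𝟭 (OpAlg P) where
  app A :=
    { toFun := fun f => ev m A f i
      map_op := fun _ _ => congrFun ((ev m A).apply_symm_apply _) i }
  naturality _ _ _ := rfl

noncomputable def homRepresentation (P : UnitaryOperad.{u}) (m : ℕ) :
    AlgRepresentation (freeFin P m) (homFunctor P m) where
  equiv _ := Equiv.refl _
  equiv_comp _ _ := rfl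
  equiv_zero A := zero_eq_homAlg_unit m A

noncomputable def freeCatRepresentation (P : UnitaryOperad.{u}) (m : FreeCat P) :
    AlgRepresentation m (inducedFunctor (freeFin P) ⋙ homFunctor P m) where
  equiv _ := InducedCategory.homEquiv
  equiv_comp _ _ := rfl
  equiv_zero A := zero_eq_homAlg_unit m (freeFin P A)

theorem generatesSums_homFunctor {θ : P.Op 2} (hθ : P.IsUnital θ) (m : ℕ) :
    GeneratesSums (homFunctor P m) :=
  (generatesSums_opAlg P).pow hθ (fun i => evAt P i) fun A => (ev m A).bijective

/-- Here the sums are formed in the full subcategory on free algebras, so the result for all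
algebras does not apply directly. -/
theorem generatesSums_freeCat {θ : P.Op 2} (hθ : P.IsUnital θ) (m : ℕ) :
    GeneratesSums (inducedFunctor (freeFin P) ⋙ homFunctor P m) :=
  (generatesSums_induced (freeFin P) (𝟭 _) ev (fun f g i => ev_comp f g i)
    freeFin_eq_opSpan).pow hθ (fun i => Functor.whiskerLeft _ (evAt P i))
      fun A => (ev m (freeFin P A)).bijective

end OpAlg

/-! ### Representations and generation for models of a theory -/

namespace PointedTheory

open PolyFunctor

variable {T : PointedTheory.{u}}

/-- The evaluation at a generator, as a homomorphism `Hom(F_T(m), M) → M(1)`. -/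
noncomputable def evAt (T : PointedTheory.{u}) {m : ℕ} (i : Fin m) :
    homFunctor T m ⋙ forget T ⟶ forget T where
  app M :=
    { toFun := fun f => ev m M (f 0) i
      map_op := fun θ x => by
        refine (congrArg (fun q => ev m M q i)
          (op_ofAlg _ ⟨homOp_comp m M, homOp_proj m M⟩ θ x 0)).trans ?_
        exact congrFun ((ev m M).apply_symm_apply _) i }
  naturality _ _ _ := rfl

/-- The model `k ↦ A^k` takes the value `A^1`, functions on `Fin 1`, at the object `1`, so
`Hom(F_T(m), M)` is recovered only up to `Equiv.funUnique`. -/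
theorem evAt_bijective (m : ℕ) (M : T.Model) :
    Function.Bijective fun (a : (((homFunctor T m ⋙ forget T).obj M)).carrier) (i : Fin m) =>
      ((evAt T i).app M).toFun a :=
  ((Equiv.funUnique (Fin 1) _).trans (ev m M)).bijective

theorem zero_eq_homFunctor_unit (m : ℕ) (M : T.Model) :
    (fun _ : Fin 1 => (0 : freeModel T m ⟶ M)) =
      ((forget T).obj ((homFunctor T m).obj M)).unit := by
  refine (evAt_bijective m M).1 (funext fun i => ?_)
  refine Eq.trans ?_ (OpAlg.map_unit ((evAt T i).app M)).symm
  exact congrArg (fun q => OpAlg.Hom.toFun q (T.proj i))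
    (forget_map_homOfAlg (0 : (forget T).obj (freeModel T m) ⟶ (forget T).obj M))

noncomputable def homRepresentation (T : PointedTheory.{u}) (m : ℕ) :
    AlgRepresentation (freeModel T m) (homFunctor T m ⋙ forget T) where
  equiv _ := (Equiv.funUnique (Fin 1) _).symm
  equiv_comp _ _ := rfl
  equiv_zero M := zero_eq_homFunctor_unit m M

noncomputable def freeCatRepresentation (T : PointedTheory.{u}) (m : FreeCat T) :
    AlgRepresentation m (inducedFunctor (freeModel T) ⋙ homFunctor T m ⋙ forget T) where
  equiv _ := InducedCategory.homEquiv.trans (Equiv.funUnique (Fin 1) _).symm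
  equiv_comp _ _ := rfl
  equiv_zero M := zero_eq_homFunctor_unit m (freeModel T M)

/-- As in the Yoneda lemma, a morphism `a : m → 1` is the operation `a` applied to the generators
`proj i`, which together form the identity of `m`. -/
theorem freeModel_eq_opSpan (m : ℕ) (a : ((forget T).obj (freeModel T m)).carrier) :
    a ∈ OpAlg.opSpan (B := (forget T).obj (freeModel T m))
      (Set.range (ev m (freeModel T m) (𝟙 _))) := by
  refine ⟨m, a, T.proj, fun i => ⟨i, rfl⟩, ?_⟩
  have h : ((freeModel T m).pow m).symm T.proj = T.id m :=
    ((freeModel T m).pow m).symm_apply_eq.2 (funext fun i => (T.id_comp (T.proj i)).symm)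
  exact ((congrArg ((freeModel T m).obj.map (X := ⟨m⟩) (Y := ⟨1⟩) a) h).trans (T.id_comp a)).symm

theorem generatesSums_homFunctor {θ : T.operad.Op 2} (hθ : T.operad.IsUnital θ) (m : ℕ) :
    GeneratesSums (homFunctor T m ⋙ forget T) :=
  (generatesSums_model T).pow hθ (fun i => evAt T i) (evAt_bijective m)

theorem generatesSums_freeCat {θ : T.operad.Op 2} (hθ : T.operad.IsUnital θ) (m : ℕ) :
    GeneratesSums (inducedFunctor (freeModel T) ⋙ homFunctor T m ⋙ forget T) :=
  (generatesSums_induced (freeModel T) (forget T) ev (fun f g i => ev_comp f g i)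
    freeModel_eq_opSpan).pow hθ (fun i => Functor.whiskerLeft _ (evAt T i))
      fun M => evAt_bijective m (freeModel T M)

end PointedTheory

/-! ### The theorem -/

theorem mainTheorem8 :
    (∀ P : UnitaryOperad.{u}, (∃ θ : P.Op 2, P.IsUnital θ) → ∀ n : ℕ,
      (∀ m : ℕ, 1 ≤ m →
        ∃ e : (PolyFunctor.taylor n).obj (PolyFunctor.univFunctor (OpAlg.freeFin P m)) ≅
            OpAlg.homFunctor P m ⋙ OpAlg.passi P n,
          ∀ (A : OpAlg P) (f : OpAlg.freeFin P m ⟶ A),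
            (e.hom.app A).hom (PolyFunctor.taylorClass n f) =
              OpAlg.passiMk n (OpAlg.homAlg m A) f) ∧
      ∃ (S : (OpAlg.passiHoms P n).Composition)
        (e : IsoCat (PolyFunctor.TaylorCat n (OpAlg.FreeCat P)) S.Cat),
        e.functor.Additive ∧
          (PolyFunctor.taylorComp n (OpAlg.FreeCat P)).functor ⋙ e.functor = S.functor) ∧
    (∀ T : PointedTheory.{u}, (∃ θ : T.operad.Op 2, T.operad.IsUnital θ) → ∀ n : ℕ,
      (∀ m : ℕ, 1 ≤ m →
        ∃ e : (PolyFunctor.taylor n).obj (PolyFunctor.univFunctor (T.freeModel m)) ≅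
            T.homFunctor m ⋙ T.passi n,
          ∀ (M : T.Model) (f : T.freeModel m ⟶ M),
            (e.hom.app M).hom (PolyFunctor.taylorClass n f) = PointedTheory.passiHom n f) ∧
      ∃ (S : (T.passiHoms n).Composition)
        (e : IsoCat (PolyFunctor.TaylorCat n T.FreeCat) S.Cat),
        e.functor.Additive ∧
          (PolyFunctor.taylorComp n T.FreeCat).functor ⋙ e.functor = S.functor) := by
  refine ⟨fun P ⟨θ, hθ⟩ n => ⟨fun m _ => ?_, ?_⟩, fun T ⟨θ, hθ⟩ n => ⟨fun m _ => ?_, ?_⟩⟩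
  · exact ⟨(OpAlg.homRepresentation P m).taylorIso (OpAlg.generatesSums_homFunctor hθ m) n,
      fun A f => (OpAlg.homRepresentation P m).taylorIso_class _ n f⟩
  -- The isomorphisms for the objects `k` of the free category, taken at the objects `l`, identify
  -- all morphism groups and match the generators `t_n(f)` and `p_n(f)`; the composition is carried
  -- across. It is the only one possible, because the `p_n(f)` generate.
  · exact (PolyFunctor.taylorComp n (OpAlg.FreeCat P)).exists_isoCat
      (fun k l => (OpAlg.freeCatRepresentation P k).taylorEquiv
        (OpAlg.generatesSums_freeCat hθ k) n l)
      fun {k l} f => (OpAlg.freeCatRepresentation P k).taylorEquiv_class _ n f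
  · exact ⟨(PointedTheory.homRepresentation T m).taylorIso
      (PointedTheory.generatesSums_homFunctor hθ m) n,
      fun M f => (PointedTheory.homRepresentation T m).taylorIso_class _ n f⟩
  · exact (PolyFunctor.taylorComp n T.FreeCat).exists_isoCat
      (fun k l => (PointedTheory.freeCatRepresentation T k).taylorEquiv
        (PointedTheory.generatesSums_freeCat hθ k) n l)
      fun {k l} f => (PointedTheory.freeCatRepresentation T k).taylorEquiv_class _ n f
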